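/- **Laakso spaces.** Let $M\ge 2$ be an integer, $\theta\in(0,1/4]$, and let $(N_n)_{n\ge1}$ be even integers $\ge 4$ such that for some $C\ge 1$ one has $C^{-1}\theta^n\le\prod_{i=1}^n N_i^{-1}\le C\theta^n$ for all $n\ge 1$. Put $\delta_i:=\frac1{N_1\cdots N_i}$ and $[M]:=\{1,\dots,M\}$. Metrise $[M]^{\mathbb N}$ by letting the distance of two distinct sequences be $\theta^n$, where $n$ is the first index at which they differ, and let $\tilde X:=[0,1]\times[M]^{\mathbb N}$ carry the product metric, with first projection $h$ (the height). For $i\ge1$ let $$W_i:=\Big\{\sum_{j=1}^i t_j\delta_j:\ t_j\in\mathbb Z,\ 0\le t_j<N_j\ (j<i),\ 1\le t_i<N_i\Big\}.$$ Identify $x,y\in\tilde X$ if $x=y$, or if for some $i$ one has $h(x)=h(y)\in W_i$ and the digit sequences of $x,y$ agree except possibly in the $i$-th digit. Let $q\colon\tilde X\to X$ be the quotient map; $h$ descends to $X$. The space $X$ with the distance $$d(x,y):=\inf\{\mathcal H^1(\gamma):\ \gamma \text{ a (not necessarily continuous) curve in }\tilde X\text{ such that } q\circ\gamma\text{ is a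 continuous curve from }x\text{ to }y\}$$ ($\mathcal H^1(\gamma)$ being the Hausdorff $1$-measure of the image of $\gamma$) is a Laakso space. **Shortcuts.** For $i\ge 1$ let $$J_i:=\Big\{\sum_{j=1}^i t_j\delta_j+\tfrac{\delta_i}{2}:\ t_j\in\mathbb Z,\ 0\le t_j<N_j\ (j<i),\ 1\le t_i<N_i-1\Big\}$$ and $\mathcal J_i:=\{q(\{t\}\times\{a\}\times[M]\times\{1\}^{\mathbb N}): t\in J_i,\ a\in[M]^{i-1}\}$. Given $\eta=(\eta_i)_{i\ge1}\subseteq(0,1]$, let $\rho_\eta(x,y):=\eta_i d(x,y)$ if $x,y\in S$ for some $S\in\mathcal J_i$, and $\rho_\eta(x,y):=d(x,y)$ otherwise, and $$d_\eta(x,y):=\inf\Big\{\sum_{i=1}^n\rho_\eta(x_{i-1},x_i):\ n\ge1,\ x_0=x,\ x_n=y\Big\}.$$ The space $(X,d_\eta)$ is called a shortcut Laakso space. **Dimensions.** For a metric space $Z$ let $\dim_T Z$ be its topological (Lebesgue covering) dimension. Let $\dim_N Z$ be its Nagata dimension, i.e. the least $n\ge0$ for which there is $c>0$ such that for every $s>0$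 the space $Z$ has a cover by sets of diameter at most $cs$ such that every set of diameter at most $s$ meets at most $n+1$ of its members. A map $f\colon Z\to Y$ of metric spaces is Lipschitz light if for some $C\in(0,\infty)$ it is $C$-Lipschitz and, for all $E\subseteq Y$ and $r\in(0,\infty)$ with $r\ge\operatorname{diam}E$, the $r$-components of $f^{-1}(E)$ (the classes of points joined by finite chains in $f^{-1}(E)$ with steps of length at most $r$) have diameter at most $Cr$. The Lipschitz dimension $\dim_L Z$ is the least $n\ge0$ for which there is a Lipschitz light map $Z\to\mathbb R^n$. **Statement.** Let $(X,d_\eta)$ be a shortcut Laakso space. Then $d_\eta$ is a distance on $X$, $$\dim_T(X,d_\eta)=\dim_N(X,d_\eta)=\dim_L(X,d_\eta)=1,$$ and the height map $h\colon(X,d_\eta)\to\mathbb R$ is Lipschitz light. -/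

import Mathlib

open scoped ENNReal

noncomputable section

/-! ### Dimensions of metric spaces -/

/-- Topological (Lebesgue covering) dimension: the least `n` such that every open cover has an
open refinement in which every point lies in at most `n + 1` members (`⊤` if there is none). -/
def topologicalDim (X : Type*) [TopologicalSpace X] : ℕ∞ :=
  sInf {m : ℕ∞ | ∃ n : ℕ, m = n ∧
    ∀ U : Set (Set X), (∀ A ∈ U, IsOpen A) → ⋃₀ U = Set.univ →
      ∃ V : Set (Set X), (∀ B ∈ V, IsOpen B) ∧ ⋃₀ V = Set.univ ∧
        (∀ B ∈ V, ∃ A ∈ U, B ⊆ A) ∧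
        ∀ x : X, {B ∈ V | x ∈ B}.encard ≤ (n : ℕ∞) + 1}

/-- Nagata dimension: the least `n` for which there is `c > 0` such that for every `s > 0` the
space has a cover by sets of diameter at most `c * s` with `s`-multiplicity at most `n + 1`, i.e.
every set of diameter at most `s` meets at most `n + 1` members of the cover. -/
def nagataDim (X : Type*) [PseudoMetricSpace X] : ℕ∞ :=
  sInf {m : ℕ∞ | ∃ n : ℕ, m = n ∧
    ∃ c : ℝ, 0 < c ∧ ∀ s : ℝ, 0 < s →
      ∃ V : Set (Set X), ⋃₀ V = Set.univ ∧
        (∀ B ∈ V, Metric.ediam B ≤ ENNReal.ofReal (c * s)) ∧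
        ∀ A : Set X, Metric.ediam A ≤ ENNReal.ofReal s →
          {B ∈ V | (B ∩ A).Nonempty}.encard ≤ (n : ℕ∞) + 1}

/-- The `r`-component of `x` in the subset `A`: the points that can be reached from `x` by an
`r`-chain contained in `A`. -/
def rComponent {X : Type*} [PseudoMetricSpace X] (A : Set X) (r : ℝ) (x : X) : Set X :=
  {y | ∃ (n : ℕ) (c : ℕ → X), c 0 = x ∧ c n = y ∧ (∀ i ≤ n, c i ∈ A) ∧
    ∀ i < n, dist (c i) (c (i + 1)) ≤ r}

/-- `C`-Lipschitz light maps. -/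
def IsLipschitzLightWith {X Y : Type*} [PseudoMetricSpace X] [PseudoMetricSpace Y]
    (C : ℝ) (f : X → Y) : Prop :=
  (∀ x y, dist (f x) (f y) ≤ C * dist x y) ∧
  ∀ (E : Set Y) (r : ℝ), 0 < r → Metric.ediam E ≤ ENNReal.ofReal r →
    ∀ x ∈ f ⁻¹' E, Metric.ediam (rComponent (f ⁻¹' E) r x) ≤ ENNReal.ofReal (C * r)

/-- Lipschitz light maps. -/
def IsLipschitzLight {X Y : Type*} [PseudoMetricSpace X] [PseudoMetricSpace Y]
    (f : X → Y) : Prop :=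
  ∃ C : ℝ, 0 < C ∧ IsLipschitzLightWith C f

/-- Lipschitz dimension: the least `n` for which there is a Lipschitz light map to Euclidean
`n`-space (`⊤` if there is none). -/
def lipschitzDim (X : Type*) [PseudoMetricSpace X] : ℕ∞ :=
  sInf {m : ℕ∞ | ∃ n : ℕ, m = n ∧
    ∃ f : X → EuclideanSpace ℝ (Fin n), IsLipschitzLight f}

/-! ### Laakso spaces

Levels are numbered from `0` here: index `i` stands for level `i + 1`, so `N i` is `N_{i+1}`, and
the digits of a point form a function on `ℕ`. The alphabet `{1, …, M}` is `Fin M`, whose element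
`0` plays the role of the letter `1`. -/

/-- The parameters `M`, `θ`, `(N_n)` of a Laakso space. -/
structure LaaksoData where
  M : ℕ
  two_le_M : 2 ≤ M
  θ : ℝ
  θ_pos : 0 < θ
  θ_le : θ ≤ 1 / 4
  N : ℕ → ℕ
  N_even : ∀ i, Even (N i)
  four_le_N : ∀ i, 4 ≤ N i
  comparable : ∃ C : ℝ, 0 < C ∧ ∀ n : ℕ,
    (∏ i ∈ Finset.range n, 1 / (N i : ℝ)) ≤ C * θ ^ n ∧
      θ ^ n ≤ C * ∏ i ∈ Finset.range n, 1 / (N i : ℝ)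

namespace LaaksoData

variable (P : LaaksoData)

/-- `scale i = 1 / (N 0 * ⋯ * N i)`. -/
def scale (i : ℕ) : ℝ := 1 / ∏ j ∈ Finset.range (i + 1), (P.N j : ℝ)

/-- The first letter of the alphabet. -/
def letterOne : Fin P.M := ⟨0, lt_of_lt_of_le Nat.zero_lt_two P.two_le_M⟩

/-- The space of digit sequences. -/
def Digits : Type := ℕ → Fin P.M

open Classical in
/-- Two different sequences whose first difference is at index `n` (at level `n + 1`) have
distance `θ ^ (n + 1)`. -/
instance : MetricSpace P.Digits where
  dist x y := if x = y then 0 else P.θ ^ (PiNat.firstDiff (E := fun _ => Fin P.M) x y + 1)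
  dist_self x := by simp
  dist_comm x y := by
    simp only [eq_comm (a := x) (b := y), PiNat.firstDiff_comm (E := fun _ => Fin P.M) x y]
  dist_triangle x y z := by
    have h0 : ∀ n : ℕ, 0 ≤ P.θ ^ n := fun n => pow_nonneg P.θ_pos.le n
    have h1 : P.θ ≤ 1 := P.θ_le.trans (by norm_num)
    by_cases hxz : x = z
    · simp only [hxz, if_true]
      refine add_nonneg ?_ ?_ <;> split_ifs <;> first | exact h0 _ | exact le_rfl
    by_cases hxy : x = y
    · simp [hxy]
    by_cases hyz : y = z
    · simp [hyz]
    simp only [hxz, hxy, hyz, if_false]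
    have h := PiNat.min_firstDiff_le (E := fun _ => Fin P.M) x y z hxz
    rcases min_le_iff.1 h with h | h
    · exact (pow_le_pow_of_le_one P.θ_pos.le h1 (Nat.succ_le_succ h)).trans
        (le_add_of_nonneg_right (h0 _))
    · exact (pow_le_pow_of_le_one P.θ_pos.le h1 (Nat.succ_le_succ h)).trans
        (le_add_of_nonneg_left (h0 _))
  eq_of_dist_eq_zero := by
    intro x y h
    by_contra hne
    have h' : (if x = y then (0 : ℝ) else
      P.θ ^ (PiNat.firstDiff (E := fun _ => Fin P.M) x y + 1)) = 0 := h
    rw [if_neg hne] at h'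
    exact (pow_pos P.θ_pos _).ne' h'

instance : MeasurableSpace P.Digits := borel P.Digits

instance : BorelSpace P.Digits := ⟨rfl⟩

/-- The product `[0,1] × [M]^ℕ`, with the product metric. -/
abbrev Cover : Type := unitInterval × P.Digits

/-- The wormhole heights of index `i`. -/
def wormholeHeights (i : ℕ) : Set ℝ :=
  {s | ∃ t : ℕ → ℕ, (∀ j < i, t j < P.N j) ∧ 1 ≤ t i ∧ t i < P.N i ∧
    s = ∑ j ∈ Finset.range (i + 1), (t j : ℝ) * P.scale j}

/-- Identification of points of `[0,1] × [M]^ℕ`. As the sets of wormhole heights of different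
levels are disjoint, this is an equivalence relation. -/
def Rel (x y : P.Cover) : Prop :=
  x = y ∨ ∃ i : ℕ, x.1 = y.1 ∧ (x.1 : ℝ) ∈ P.wormholeHeights i ∧ ∀ j, j ≠ i → x.2 j = y.2 j

/-- The Laakso space as a topological space, with the quotient topology. -/
abbrev Space : Type := Quot P.Rel

/-- The quotient map. -/
def proj (x : P.Cover) : P.Space := Quot.mk P.Rel x

/-- The height. -/
def height : P.Space → ℝ :=
  Quot.lift (fun x => (x.1 : ℝ)) (by
    rintro x y (h | ⟨i, h, -⟩)
    · rw [h]
    · exact congrArg Subtype.val h)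

/-- The Laakso distance: the infimum of `ℋ¹(γ)` over the (possibly discontinuous) curves `γ` in
`[0,1] × [M]^ℕ` whose projection is a continuous curve from `x` to `y`. -/
def laaksoDist (x y : P.Space) : ℝ :=
  (⨅ (γ : unitInterval → P.Cover) (_ : Continuous (P.proj ∘ γ) ∧ P.proj (γ 0) = x ∧
    P.proj (γ 1) = y), MeasureTheory.Measure.hausdorffMeasure 1 (Set.range γ) : ℝ≥0∞).toReal

/-! ### Shortcuts -/

/-- The heights of the shortcuts of index `i`. -/
def shortcutHeights (i : ℕ) : Set ℝ :=
  {s | ∃ t : ℕ → ℕ, (∀ j < i, t j < P.N j) ∧ 1 ≤ t i ∧ t i + 1 < P.N i ∧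
    s = (∑ j ∈ Finset.range (i + 1), (t j : ℝ) * P.scale j) + P.scale i / 2}

/-- The shortcuts of index `i`: the images of the sets `{t} × {a} × [M] × {1}^ℕ` with `t` a
shortcut height and `a` a word in the digits of index `< i`. -/
def shortcuts (i : ℕ) : Set (Set P.Space) :=
  {S | ∃ t ∈ P.shortcutHeights i, ∃ a : ℕ → Fin P.M,
    S = P.proj '' {x | (x.1 : ℝ) = t ∧ (∀ j < i, x.2 j = a j) ∧ ∀ j > i, x.2 j = P.letterOne}}

open Classical in
/-- The cost `ρ_η` of a jump. Shortcuts are pairwise disjoint, so the index found is the only one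
for which `x` and `y` lie in a common shortcut. -/
def jumpCost (η : ℕ → Set.Ioc (0 : ℝ) 1) (x y : P.Space) : ℝ :=
  if h : ∃ i, ∃ S ∈ P.shortcuts i, x ∈ S ∧ y ∈ S then
    (η (Nat.find h) : ℝ) * P.laaksoDist x y
  else P.laaksoDist x y

/-- The shortcut distance `d_η`: the infimum of the total costs of chains from `x` to `y`. -/
def shortcutDist (η : ℕ → Set.Ioc (0 : ℝ) 1) (x y : P.Space) : ℝ :=
  sInf {s : ℝ | ∃ (n : ℕ) (c : ℕ → P.Space), 1 ≤ n ∧ c 0 = x ∧ c n = y ∧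
    s = ∑ i ∈ Finset.range n, P.jumpCost η (c i) (c (i + 1))}

theorem laaksoDist_self (x : P.Space) : P.laaksoDist x x = 0 := by
  obtain ⟨x, rfl⟩ := Quot.exists_rep x
  have : (⨅ (γ : unitInterval → P.Cover) (_ : Continuous (P.proj ∘ γ) ∧
      P.proj (γ 0) = P.proj x ∧ P.proj (γ 1) = P.proj x),
      MeasureTheory.Measure.hausdorffMeasure 1 (Set.range γ) : ℝ≥0∞) ≤ 0 := by
    refine iInf₂_le_of_le (fun _ => x) ⟨continuous_const, rfl, rfl⟩ ?_
    rw [Set.range_const]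
    have := MeasureTheory.Measure.nullSingletonClass_hausdorff P.Cover (zero_lt_one (α := ℝ))
    exact (MeasureTheory.measure_singleton x).le
  change ENNReal.toReal _ = 0
  rw [show (⨅ (γ : unitInterval → P.Cover) (_ : Continuous (P.proj ∘ γ) ∧
      P.proj (γ 0) = Quot.mk P.Rel x ∧ P.proj (γ 1) = Quot.mk P.Rel x),
      MeasureTheory.Measure.hausdorffMeasure 1 (Set.range γ) : ℝ≥0∞) = 0
    from le_antisymm this bot_le]
  rfl

theorem laaksoDist_comm (x y : P.Space) : P.laaksoDist x y = P.laaksoDist y x := by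
  have key : ∀ x y : P.Space,
      (⨅ (γ : unitInterval → P.Cover) (_ : Continuous (P.proj ∘ γ) ∧ P.proj (γ 0) = x ∧
        P.proj (γ 1) = y), MeasureTheory.Measure.hausdorffMeasure 1 (Set.range γ) : ℝ≥0∞) ≤
      ⨅ (γ : unitInterval → P.Cover) (_ : Continuous (P.proj ∘ γ) ∧ P.proj (γ 0) = y ∧
        P.proj (γ 1) = x), MeasureTheory.Measure.hausdorffMeasure 1 (Set.range γ) := by
    intro x y
    refine le_iInf₂ fun γ hγ => iInf₂_le_of_le (γ ∘ unitInterval.symm) ⟨?_, ?_, ?_⟩ ?_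
    · exact hγ.1.comp unitInterval.continuous_symm
    · simpa using hγ.2.2
    · simpa using hγ.2.1
    · exact MeasureTheory.measure_mono (Set.range_comp_subset_range _ _)
  exact congrArg ENNReal.toReal (le_antisymm (key x y) (key y x))

variable (η : ℕ → Set.Ioc (0 : ℝ) 1)

theorem jumpCost_nonneg (x y : P.Space) : 0 ≤ P.jumpCost η x y := by
  unfold jumpCost
  split_ifs with h
  · exact mul_nonneg (η _).2.1.le ENNReal.toReal_nonneg
  · exact ENNReal.toReal_nonneg

theorem jumpCost_self (x : P.Space) : P.jumpCost η x x = 0 := by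
  simp [jumpCost, laaksoDist_self]

theorem jumpCost_comm (x y : P.Space) : P.jumpCost η x y = P.jumpCost η y x := by
  classical
  have key : ∀ p q : ℕ → Prop, p = q → ∀ a : ℝ,
      (if h : ∃ i, p i then (η (Nat.find h) : ℝ) * a else a) =
        if h : ∃ i, q i then (η (Nat.find h) : ℝ) * a else a := by
    rintro p q rfl a
    rfl
  have := key (fun i => ∃ S ∈ P.shortcuts i, x ∈ S ∧ y ∈ S)
    (fun i => ∃ S ∈ P.shortcuts i, y ∈ S ∧ x ∈ S)
    (by simp only [and_comm (a := x ∈ _)]) (P.laaksoDist x y)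
  unfold jumpCost
  rw [← P.laaksoDist_comm x y]
  convert this

theorem shortcutDist_bddBelow (x y : P.Space) :
    BddBelow {s : ℝ | ∃ (n : ℕ) (c : ℕ → P.Space), 1 ≤ n ∧ c 0 = x ∧ c n = y ∧
      s = ∑ i ∈ Finset.range n, P.jumpCost η (c i) (c (i + 1))} := by
  refine ⟨0, ?_⟩
  rintro s ⟨n, c, -, -, -, rfl⟩
  exact Finset.sum_nonneg fun i _ => P.jumpCost_nonneg η _ _

theorem shortcutDist_nonempty (x y : P.Space) :
    {s : ℝ | ∃ (n : ℕ) (c : ℕ → P.Space), 1 ≤ n ∧ c 0 = x ∧ c n = y ∧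
      s = ∑ i ∈ Finset.range n, P.jumpCost η (c i) (c (i + 1))}.Nonempty :=
  ⟨_, 1, fun i => if i = 0 then x else y, le_rfl, by simp, by simp, rfl⟩

theorem shortcutDist_self (x : P.Space) : P.shortcutDist η x x = 0 := by
  refine le_antisymm ?_ ?_
  · refine csInf_le (P.shortcutDist_bddBelow η x x) ⟨1, fun _ => x, le_rfl, rfl, rfl, ?_⟩
    simp [jumpCost_self]
  · refine le_csInf (P.shortcutDist_nonempty η x x) ?_
    rintro s ⟨n, c, -, -, -, rfl⟩
    exact Finset.sum_nonneg fun i _ => P.jumpCost_nonneg η _ _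

theorem shortcutDist_comm (x y : P.Space) : P.shortcutDist η x y = P.shortcutDist η y x := by
  have key : ∀ x y : P.Space, P.shortcutDist η x y ≤ P.shortcutDist η y x := by
    intro x y
    refine le_csInf (P.shortcutDist_nonempty η y x) ?_
    rintro s ⟨n, c, hn, h0, h1, rfl⟩
    refine csInf_le (P.shortcutDist_bddBelow η x y)
      ⟨n, fun i => c (n - i), hn, by simpa using h1, by simpa using h0, ?_⟩
    rw [← Finset.sum_range_reflect]
    refine Finset.sum_congr rfl fun i hi => ?_
    have hi := Finset.mem_range.1 hi
    rw [P.jumpCost_comm η]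
    congr 2 <;> omega
  exact le_antisymm (key x y) (key y x)

theorem shortcutDist_triangle (x y z : P.Space) :
    P.shortcutDist η x z ≤ P.shortcutDist η x y + P.shortcutDist η y z := by
  refine le_of_forall_pos_lt_add fun ε hε => ?_
  obtain ⟨s, ⟨n, c, hn, hc0, hc1, rfl⟩, hs⟩ := exists_lt_of_csInf_lt
    (P.shortcutDist_nonempty η x y) (lt_add_of_pos_right (P.shortcutDist η x y) (half_pos hε))
  obtain ⟨s, ⟨m, e, hm, he0, he1, rfl⟩, hs'⟩ := exists_lt_of_csInf_lt
    (P.shortcutDist_nonempty η y z) (lt_add_of_pos_right (P.shortcutDist η y z) (half_pos hε))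
  have hle : P.shortcutDist η x z ≤ (∑ i ∈ Finset.range n, P.jumpCost η (c i) (c (i + 1))) +
      ∑ i ∈ Finset.range m, P.jumpCost η (e i) (e (i + 1)) := by
    refine csInf_le (P.shortcutDist_bddBelow η x z)
      ⟨n + m, fun i => if i < n then c i else e (i - n), by omega, ?_, ?_, ?_⟩
    · simp [show 0 < n by omega, hc0]
    · simp [he1]
    · rw [Finset.sum_range_add]
      congr 1
      · refine Finset.sum_congr rfl fun i hi => ?_
        have hi := Finset.mem_range.1 hi
        by_cases h : i + 1 < n
        · simp [hi, h]
        · have h' : i + 1 = n := by omega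
          simp [hi, h', hc1, he0]
      · refine Finset.sum_congr rfl fun i _ => ?_
        simp [add_assoc]
  linarith

/-- The shortcut Laakso space: the set `P.Space` with the distance `d_η`. -/
def ShortcutSpace (_η : ℕ → Set.Ioc (0 : ℝ) 1) : Type := P.Space

instance : PseudoMetricSpace (P.ShortcutSpace η) where
  dist := P.shortcutDist η
  dist_self := P.shortcutDist_self η
  dist_comm := P.shortcutDist_comm η
  dist_triangle := P.shortcutDist_triangle η

/-- The height on the shortcut Laakso space. -/
def shortcutHeight : P.ShortcutSpace η → ℝ := P.height

end LaaksoData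

end

/-!
Cutting the preimages of a good cover under a Lipschitz light map into their components shows that
such a map does not lower the Nagata dimension. Hence a compact connected metric space with more
than one point and a Lipschitz light map to `ℝ` has topological, Nagata and Lipschitz dimension `1`.

The shortcut Laakso space is compact and connected because it is a continuous image of the Laakso
space, so everything rests on the lightness of the height. Over a short interval `I` there is at
most one wormhole height of small index, so up to a small error a point over `I` is determined by
its digits of small index, excepting the digit switched at that wormhole. A jump that changes
another such digit either travels to a distant wormhole, which is expensive, or takes a shortcut. A
shortcut height is itself a wormhole height of the next index, so all shortcuts over `I` of small
index are at a single height. Hence a chain of cheap jumps over `I` can only jump to and fro within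
one shortcut, which is a set of small diameter for `d_η` because one cheap jump crosses it.
-/

noncomputable section

open Set Filter Topology

section Components

variable {X : Type*} [PseudoMetricSpace X] {A : Set X} {r : ℝ} {x y z : X}

theorem dist_le_of_ediam_le (hr : 0 ≤ r) (h : Metric.ediam A ≤ ENNReal.ofReal r) (hx : x ∈ A)
    (hy : y ∈ A) : dist x y ≤ r :=
  (edist_le_ofReal hr).1 ((Metric.edist_le_ediam_of_mem hx hy).trans h)

theorem mem_rComponent_iff :
    y ∈ rComponent A r x ↔
      x ∈ A ∧ Relation.ReflTransGen (fun p q => p ∈ A ∧ q ∈ A ∧ dist p q ≤ r) x y := by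
  constructor
  · rintro ⟨n, c, rfl, rfl, hA, hd⟩
    refine ⟨hA 0 (Nat.zero_le _), ?_⟩
    exact reflTransGen_of_succ_of_le _ (fun i hi => ⟨hA i hi.2.le, hA _ hi.2, hd i hi.2⟩)
      (Nat.zero_le n) |>.lift c fun _ _ h => h
  · rintro ⟨hx, h⟩
    induction h with
    | refl => exact ⟨0, fun _ => x, rfl, rfl, fun _ _ => hx, fun _ h => absurd h (by omega)⟩
    | @tail y z _ hyz ih =>
      obtain ⟨n, c, h0, hn, hA, hd⟩ := ih
      refine ⟨n + 1, fun i => if i ≤ n then c i else z, by simpa using h0, by simp, ?_, ?_⟩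
      · intro i _
        by_cases hi : i ≤ n
        · simpa only [hi, if_true] using hA i hi
        · simpa only [hi, if_false] using hyz.2.1
      · intro i hi
        by_cases hi' : i + 1 ≤ n
        · simpa only [hi', show i ≤ n by omega, if_true] using hd i (by omega)
        · obtain rfl : i = n := by omega
          simpa [hn] using hyz.2.2

theorem mem_rComponent_of_dist_le (hx : x ∈ A) (hy : y ∈ A) (h : dist x y ≤ r) :
    y ∈ rComponent A r x :=
  mem_rComponent_iff.2 ⟨hx, .single ⟨hx, hy, h⟩⟩

theorem mem_rComponent_self (hx : x ∈ A) : x ∈ rComponent A r x :=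
  mem_rComponent_iff.2 ⟨hx, .refl⟩

theorem rComponent_subset : rComponent A r x ⊆ A := by
  rintro y ⟨n, c, -, rfl, h, -⟩
  exact h n le_rfl

theorem mem_rComponent_symm (h : y ∈ rComponent A r x) : x ∈ rComponent A r y := by
  have hy := rComponent_subset h
  rw [mem_rComponent_iff] at h ⊢
  have : Std.Symm fun p q : X => p ∈ A ∧ q ∈ A ∧ dist p q ≤ r :=
    ⟨fun p q hpq => ⟨hpq.2.1, hpq.1, dist_comm p q ▸ hpq.2.2⟩⟩
  exact ⟨hy, Std.Symm.symm (r := Relation.ReflTransGen _) _ _ h.2⟩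

theorem mem_rComponent_trans (hxy : y ∈ rComponent A r x) (hyz : z ∈ rComponent A r y) :
    z ∈ rComponent A r x := by
  rw [mem_rComponent_iff] at hxy hyz ⊢
  exact ⟨hxy.1, hxy.2.trans hyz.2⟩

theorem rComponent_eq_of_mem (h : y ∈ rComponent A r x) : rComponent A r y = rComponent A r x :=
  Subset.antisymm (fun _ => mem_rComponent_trans h)
    fun _ => mem_rComponent_trans (mem_rComponent_symm h)

theorem encard_rComponent_le {Y : Type*} {f : X → Y} {V : Set (Set Y)}
    (hA : ∀ a ∈ A, ∀ b ∈ A, dist a b ≤ r) :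
    {B | (∃ D ∈ V, ∃ x ∈ f ⁻¹' D, B = rComponent (f ⁻¹' D) r x) ∧ (B ∩ A).Nonempty}.encard ≤
      {D ∈ V | (D ∩ f '' A).Nonempty}.encard := by
  refine (encard_le_encard ?_).trans
    (encard_image_le (fun D => ⋃ a ∈ A ∩ f ⁻¹' D, rComponent (f ⁻¹' D) r a) _)
  rintro _ ⟨⟨D, hD, x, -, rfl⟩, a, ha, haA⟩
  have haD : a ∈ f ⁻¹' D := rComponent_subset ha
  have hcomp : ∀ b ∈ A ∩ f ⁻¹' D, rComponent (f ⁻¹' D) r b = rComponent (f ⁻¹' D) r x :=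
    fun b hb => (rComponent_eq_of_mem (mem_rComponent_of_dist_le haD hb.2 (hA a haA b hb.1))).trans
      (rComponent_eq_of_mem ha)
  have hne : (A ∩ f ⁻¹' D).Nonempty := ⟨a, haA, haD⟩
  exact ⟨D, ⟨hD, f a, haD, a, haA, rfl⟩, (iUnion₂_congr hcomp).trans (biUnion_const hne _)⟩

end Components

section CoveringDimensions

theorem one_le_sInf_natCast {p : ℕ → Prop} (h : ¬ p 0) :
    1 ≤ sInf {m : ℕ∞ | ∃ n : ℕ, m = n ∧ p n} := by
  refine le_sInf ?_
  rintro _ ⟨n, rfl, hn⟩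
  have : n ≠ 0 := by
    rintro rfl
    exact h hn
  exact_mod_cast Nat.one_le_iff_ne_zero.2 this

theorem isClopen_of_mem_cover {X : Type*} [TopologicalSpace X] {V : Set (Set X)}
    (hopen : ∀ B ∈ V, IsOpen B) (hcover : ⋃₀ V = univ)
    (hmult : ∀ x, {B ∈ V | x ∈ B}.encard ≤ 1) {B : Set X} (hB : B ∈ V) : IsClopen B := by
  have hcompl : Bᶜ = ⋃₀ (V \ {B}) := by
    ext x
    constructor
    · intro hx
      obtain ⟨B', hB', hxB'⟩ := hcover.ge (mem_univ x)
      refine ⟨B', ⟨hB', ?_⟩, hxB'⟩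
      rintro rfl
      exact hx hxB'
    · rintro ⟨B', ⟨hB', hne⟩, hxB'⟩ hx
      exact hne (encard_le_one_iff.1 (hmult x) B' B ⟨hB', hxB'⟩ ⟨hB, hx⟩)
  refine ⟨⟨?_⟩, hopen B hB⟩
  rw [hcompl]
  exact isOpen_sUnion fun B' hB' => hopen B' hB'.1

theorem one_le_topologicalDim (X : Type*) [TopologicalSpace X] [T1Space X] [PreconnectedSpace X]
    [Nontrivial X] : 1 ≤ topologicalDim X := by
  refine one_le_sInf_natCast fun H => ?_
  obtain ⟨x, y, hxy⟩ := exists_pair_ne X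
  have hcover : ⋃₀ ({{x}ᶜ, {y}ᶜ} : Set (Set X)) = univ := by
    rw [sUnion_pair, ← compl_inter, (disjoint_singleton.2 hxy).inter_eq, compl_empty]
  obtain ⟨V, hopen, hV, hrefine, hmult⟩ := H {{x}ᶜ, {y}ᶜ} (by simp) hcover
  obtain ⟨B, hB, hxB⟩ := hV.ge (mem_univ x)
  have hB_univ : B = univ :=
    (isClopen_of_mem_cover hopen hV (by simpa using hmult) hB).eq_univ ⟨x, hxB⟩
  obtain ⟨_, rfl | rfl, hBA⟩ := hrefine B hB
  · exact hBA hxB rfl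
  · exact hBA (hB_univ ▸ mem_univ y) rfl

theorem topologicalDim_le_nagataDim (X : Type*) [PseudoMetricSpace X] [CompactSpace X] :
    topologicalDim X ≤ nagataDim X := by
  refine sInf_le_sInf ?_
  rintro _ ⟨n, rfl, c, hc, H⟩
  refine ⟨n, rfl, fun U hU hcov => ?_⟩
  obtain ⟨δ, hδ, hlebesgue⟩ := lebesgue_number_lemma_of_metric_sUnion isCompact_univ hU hcov.ge
  set s : ℝ := δ / (c + 2) with hs
  have hs_pos : 0 < s := by positivity
  have hδs : s * (c + 2) = δ := by
    rw [hs]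
    field_simp
  obtain ⟨V, hVcov, hVdiam, hVmult⟩ := H s hs_pos
  refine ⟨Metric.thickening (s / 2) '' {B ∈ V | B.Nonempty}, ?_, ?_, ?_, fun x => ?_⟩
  · rintro _ ⟨B, -, rfl⟩
    exact Metric.isOpen_thickening
  · refine eq_univ_of_forall fun x => ?_
    obtain ⟨B, hB, hx⟩ := hVcov.ge (mem_univ x)
    exact ⟨_, ⟨B, ⟨hB, x, hx⟩, rfl⟩, Metric.self_subset_thickening (by positivity) B hx⟩
  · rintro _ ⟨B, ⟨hB, x, hx⟩, rfl⟩
    obtain ⟨A, hA, hball⟩ := hlebesgue x (mem_univ x)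
    refine ⟨A, hA, fun y hy => hball (Metric.mem_ball.2 ?_)⟩
    obtain ⟨z, hz, hyz⟩ := Metric.mem_thickening_iff.1 hy
    have hzx := dist_le_of_ediam_le (by positivity) (hVdiam B hB) hz hx
    linarith [dist_triangle y z x]
  · -- `x` lies in the thickening of `B` iff `B` meets the ball of radius `s / 2` about `x`.
    have hball : Metric.ediam (Metric.ball x (s / 2)) ≤ ENNReal.ofReal s := by
      refine Metric.ediam_le fun y hy z hz => (edist_le_ofReal hs_pos.le).2 ?_
      linarith [dist_triangle_right y z x, Metric.mem_ball.1 hy, Metric.mem_ball.1 hz]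
    refine le_trans ?_ (hVmult _ hball)
    refine (encard_le_encard ?_).trans (encard_image_le (Metric.thickening (s / 2)) _)
    rintro _ ⟨⟨B, ⟨hB, -⟩, rfl⟩, hx⟩
    obtain ⟨z, hz, hxz⟩ := Metric.mem_thickening_iff.1 hx
    exact ⟨B, ⟨hB, z, hz, Metric.mem_ball'.2 hxz⟩, rfl⟩

theorem nagataDim_of_subsingleton (X : Type*) [PseudoMetricSpace X] [Subsingleton X] :
    nagataDim X = 0 := by
  refine le_antisymm (sInf_le ⟨0, rfl, 1, one_pos, fun s _ => ⟨{univ}, sUnion_singleton _, ?_⟩⟩)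
    bot_le
  refine ⟨fun B _ => by simp [Metric.ediam_subsingleton subsingleton_of_subsingleton],
    fun A _ => (encard_le_encard (sep_subset _ _)).trans ?_⟩
  simp

theorem encard_floor_image_le {A : Set ℝ} (hA : ∀ a ∈ A, ∀ b ∈ A, b ≤ a + 1) :
    ((fun t : ℝ => ⌊t⌋) '' A).encard ≤ 2 := by
  rcases A.eq_empty_or_nonempty with rfl | hne
  · simp
  have hbdd : BddBelow A := by
    obtain ⟨a, ha⟩ := hne
    exact ⟨a - 1, fun b hb => by linarith [hA b hb a ha]⟩
  have hsub : (fun t : ℝ => ⌊t⌋) '' A ⊆ {⌊sInf A⌋, ⌊sInf A⌋ + 1} := by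
    rintro _ ⟨b, hb, rfl⟩
    have hlow : ⌊sInf A⌋ ≤ ⌊b⌋ := Int.floor_mono (csInf_le hbdd hb)
    have hupp : ⌊b⌋ ≤ ⌊sInf A⌋ + 1 := by
      rw [← Int.floor_add_one]
      refine Int.floor_mono (sub_le_iff_le_add.1 (le_csInf hne fun a ha => ?_))
      linarith [hA a ha b hb]
    rcases hlow.eq_or_lt with h | h
    · exact Or.inl h.symm
    · exact Or.inr (le_antisymm hupp h)
  exact (encard_le_encard hsub).trans
    ((encard_insert_le _ _).trans (by norm_num [encard_singleton]))

theorem nagataDim_real_le_one : nagataDim ℝ ≤ 1 := by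
  refine sInf_le ⟨1, rfl, 1, one_pos, fun s hs => ?_⟩
  let cell (k : ℤ) : Set ℝ := {t | ⌊t / s⌋ = k}
  refine ⟨range cell, eq_univ_of_forall fun t => ⟨_, mem_range_self ⌊t / s⌋, rfl⟩, ?_,
    fun A hA => ?_⟩
  · rintro _ ⟨k, rfl⟩
    refine Metric.ediam_le fun a ha b hb => (edist_le_ofReal (by positivity)).2 ?_
    have hfloor : ⌊a / s⌋ = ⌊b / s⌋ := Eq.trans ha (Eq.symm hb)
    have h := Int.abs_sub_lt_one_of_floor_eq_floor hfloor
    rw [← sub_div, abs_div, abs_of_pos hs, div_lt_one hs] at h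
    rw [Real.dist_eq, one_mul]
    exact h.le
  · have hdist : ∀ a ∈ A, ∀ b ∈ A, b / s ≤ a / s + 1 := fun a ha b hb => by
      have h := (le_abs_self _).trans (dist_le_of_ediam_le hs.le hA hb ha)
      rw [div_add_one hs.ne']
      gcongr
      linarith
    have hsub : {B ∈ range cell | (B ∩ A).Nonempty} ⊆
        cell '' ((fun t : ℝ => ⌊t⌋) '' ((· / s) '' A)) := by
      rintro _ ⟨⟨k, rfl⟩, a, hak, haA⟩
      exact ⟨k, ⟨_, ⟨a, haA, rfl⟩, hak⟩, rfl⟩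
    refine (encard_le_encard hsub).trans ((encard_image_le _ _).trans ?_)
    exact (encard_floor_image_le (by simpa using hdist)).trans (by norm_num)

end CoveringDimensions

section LightMaps

variable {X Y Z : Type*} [PseudoMetricSpace X] [PseudoMetricSpace Y] [PseudoMetricSpace Z]
  {f : X → Y}

theorem isLipschitzLight_of_dist_le {C : ℝ} (hC : 0 ≤ C)
    (hlip : ∀ x y, dist (f x) (f y) ≤ C * dist x y)
    (hlight : ∀ (E : Set Y) (r : ℝ), 0 < r → Metric.ediam E ≤ ENNReal.ofReal r →
      ∀ x ∈ f ⁻¹' E, ∀ y ∈ rComponent (f ⁻¹' E) r x, dist x y ≤ C * r) :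
    IsLipschitzLight f := by
  refine ⟨2 * C + 1, by positivity, fun x y => (hlip x y).trans ?_, fun E r hr hE x hx => ?_⟩
  · nlinarith [dist_nonneg (x := x) (y := y)]
  · refine Metric.ediam_le fun y hy z hz => (edist_le_ofReal (by positivity)).2 ?_
    linarith [dist_triangle_left y z x, hlight E r hr hE x hx y hy, hlight E r hr hE x hx z hz]

theorem IsLipschitzLight.nagataDim_le (hf : IsLipschitzLight f) : nagataDim X ≤ nagataDim Y := by
  obtain ⟨C, hC, hlip, hlight⟩ := hf
  refine sInf_le_sInf ?_
  rintro _ ⟨n, rfl, c, hc, H⟩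
  refine ⟨n, rfl, C * max (c * C) 1, by positivity, fun s hs => ?_⟩
  obtain ⟨V, hVcov, hVdiam, hVmult⟩ := H (C * s) (by positivity)
  set r := max (c * C) 1 * s with hr
  have hr_pos : 0 < r := by positivity
  have hsr : s ≤ r := le_mul_of_one_le_left hs.le (le_max_right _ _)
  refine ⟨{B | ∃ D ∈ V, ∃ x ∈ f ⁻¹' D, B = rComponent (f ⁻¹' D) r x}, ?_, ?_, fun A hA => ?_⟩
  · refine eq_univ_of_forall fun x => ?_
    obtain ⟨D, hD, hx⟩ := hVcov.ge (mem_univ (f x))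
    exact ⟨_, ⟨D, hD, x, hx, rfl⟩, mem_rComponent_self hx⟩
  · rintro _ ⟨D, hD, x, hx, rfl⟩
    rw [mul_assoc, ← hr]
    refine hlight D r hr_pos ((hVdiam D hD).trans (ENNReal.ofReal_le_ofReal ?_)) x hx
    rw [← mul_assoc, hr]
    gcongr
    exact le_max_left _ _
  · have hdist : ∀ a ∈ A, ∀ b ∈ A, dist a b ≤ s := fun a ha b hb =>
      dist_le_of_ediam_le hs.le hA ha hb
    refine (encard_rComponent_le fun a ha b hb => (hdist a ha b hb).trans hsr).trans
      (hVmult (f '' A) (Metric.ediam_le ?_))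
    rintro _ ⟨a, ha, rfl⟩ _ ⟨b, hb, rfl⟩
    refine (edist_le_ofReal (by positivity)).2 ((hlip a b).trans ?_)
    gcongr
    exact hdist a ha b hb

theorem IsLipschitzLight.isometry_comp (hf : IsLipschitzLight f) {g : Y → Z} (hg : Isometry g) :
    IsLipschitzLight (g ∘ f) := by
  obtain ⟨C, hC, hlip, hlight⟩ := hf
  refine ⟨C, hC, fun x y => by simpa [hg.dist_eq] using hlip x y, fun E r hr hE x hx => ?_⟩
  rw [preimage_comp]
  refine hlight _ r hr (le_trans ?_ hE) x hx
  rw [← hg.ediam_image]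
  exact Metric.ediam_mono (image_preimage_subset g E)

theorem lipschitzDim_le_one_of_isLipschitzLight {f : X → ℝ} (hf : IsLipschitzLight f) :
    lipschitzDim X ≤ 1 :=
  sInf_le ⟨1, rfl, _, hf.isometry_comp (g := EuclideanSpace.single (0 : Fin 1)) <|
    Isometry.of_dist_eq fun a b => by simp⟩

theorem one_le_lipschitzDim (h : 1 ≤ nagataDim X) : 1 ≤ lipschitzDim X := by
  refine one_le_sInf_natCast ?_
  rintro ⟨f, hf⟩
  have h0 := h.trans hf.nagataDim_le
  rw [nagataDim_of_subsingleton] at h0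
  exact absurd h0 (by simp)

theorem IsLipschitzLight.dims_eq_one {X : Type*} [MetricSpace X] [CompactSpace X]
    [PreconnectedSpace X] [Nontrivial X] {f : X → ℝ} (hf : IsLipschitzLight f) :
    topologicalDim X = 1 ∧ nagataDim X = 1 ∧ lipschitzDim X = 1 := by
  have htop : 1 ≤ topologicalDim X := one_le_topologicalDim X
  have hle := topologicalDim_le_nagataDim X
  have hnagata : nagataDim X ≤ 1 := hf.nagataDim_le.trans nagataDim_real_le_one
  exact ⟨(hle.trans hnagata).antisymm htop, hnagata.antisymm (htop.trans hle),
    (lipschitzDim_le_one_of_isLipschitzLight hf).antisymm (one_le_lipschitzDim (htop.trans hle))⟩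

end LightMaps

end

noncomputable section

namespace LaaksoData

open Set Filter Topology

variable (P : LaaksoData)

section Grids

theorem N_pos (i : ℕ) : 0 < P.N i := lt_of_lt_of_le (by norm_num) (P.four_le_N i)

/-- The side length `1 / (N 0 * ⋯ * N (n - 1))` of the grid of index `n`: the quantity `δ_n` of the
paper, with `δ_0 = 1`. -/
def mesh (n : ℕ) : ℝ := 1 / ∏ j ∈ Finset.range n, (P.N j : ℝ)

theorem scale_eq_mesh (i : ℕ) : P.scale i = P.mesh (i + 1) := rfl

theorem mesh_pos (n : ℕ) : 0 < P.mesh n :=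
  one_div_pos.2 (Finset.prod_pos fun j _ => by exact_mod_cast P.N_pos j)

theorem mesh_zero : P.mesh 0 = 1 := by simp [mesh]

theorem mesh_eq (n : ℕ) : P.mesh n = P.N n * P.mesh (n + 1) := by
  have h : (P.N n : ℝ) ≠ 0 := by exact_mod_cast (P.N_pos n).ne'
  rw [mesh, mesh, Finset.prod_range_succ]
  field_simp

theorem mesh_succ_le (n : ℕ) : P.mesh (n + 1) ≤ P.mesh n / 4 := by
  have h : (4 : ℝ) ≤ P.N n := by exact_mod_cast P.four_le_N n
  rw [P.mesh_eq n]
  nlinarith [P.mesh_pos (n + 1)]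

theorem mesh_strictAnti : StrictAnti P.mesh :=
  strictAnti_nat_of_succ_lt fun n => by linarith [P.mesh_succ_le n, P.mesh_pos n]

theorem mesh_tendsto : Tendsto P.mesh atTop (𝓝 0) := by
  have hle : ∀ n, P.mesh n ≤ (1 / 4) ^ n := fun n => by
    induction n with
    | zero => simp [mesh_zero]
    | succ n ih =>
      rw [pow_succ]
      linarith [P.mesh_succ_le n]
  exact squeeze_zero (fun n => (P.mesh_pos n).le) hle
    (tendsto_pow_atTop_nhds_zero_of_lt_one (by norm_num) (by norm_num))

theorem exists_mem_Ico_mesh {n : ℕ} {h : ℝ} (h0 : 0 < h) (hn : h < P.mesh n) :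
    ∃ k, n ≤ k ∧ h ∈ Ico (P.mesh (k + 1)) (P.mesh k) := by
  classical
  have hex : ∃ k, P.mesh k ≤ h := (P.mesh_tendsto.eventually (gt_mem_nhds h0)).exists.imp
    fun k hk => hk.le
  have hlt : n < Nat.find hex := by
    by_contra hle
    linarith [Nat.find_spec hex, P.mesh_strictAnti.antitone (not_lt.1 hle)]
  obtain ⟨k, hk⟩ := Nat.exists_eq_succ_of_ne_zero (Nat.ne_zero_of_lt hlt)
  have hspec := Nat.find_spec hex
  rw [hk] at hspec
  exact ⟨k, by omega, hspec, not_le.1 (Nat.find_min hex (by omega))⟩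

theorem exists_mesh_le : ∃ C : ℝ, 0 < C ∧ ∀ n, P.mesh n ≤ C * P.mesh (n + 1) := by
  obtain ⟨C, hC, h⟩ := P.comparable
  have hmesh : ∀ n, ∏ i ∈ Finset.range n, 1 / (P.N i : ℝ) = P.mesh n := fun n => by
    rw [mesh, Finset.prod_div_distrib, Finset.prod_const_one]
  simp only [hmesh] at h
  have hθ := P.θ_pos
  refine ⟨C * C / P.θ, by positivity, fun n => ?_⟩
  calc P.mesh n ≤ C * P.θ ^ n := (h n).1
    _ = C * (P.θ ^ (n + 1) / P.θ) := by rw [pow_succ, mul_div_cancel_right₀ _ hθ.ne']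
    _ ≤ C * (C * P.mesh (n + 1) / P.θ) := by
      gcongr
      exact (h (n + 1)).2
    _ = C * C / P.θ * P.mesh (n + 1) := by ring

/-- The nonnegative multiples of `mesh n`. -/
def grid (n : ℕ) : Set ℝ := {s | ∃ m : ℕ, s = m * P.mesh n}

variable {P} {n : ℕ} {s u v : ℝ}

theorem nonneg_of_mem_grid (hu : u ∈ P.grid n) : 0 ≤ u := by
  obtain ⟨m, rfl⟩ := hu
  exact mul_nonneg m.cast_nonneg (P.mesh_pos n).le

theorem zero_mem_grid : 0 ∈ P.grid n := ⟨0, by simp⟩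

theorem add_mul_mesh_mem_grid (hu : u ∈ P.grid n) (t : ℕ) :
    u + t * P.mesh (n + 1) ∈ P.grid (n + 1) := by
  obtain ⟨m, rfl⟩ := hu
  refine ⟨m * P.N n + t, ?_⟩
  rw [P.mesh_eq n]
  push_cast
  ring

theorem grid_mono : Monotone P.grid :=
  monotone_nat_of_le_succ fun n u hu => by simpa using add_mul_mesh_mem_grid hu 0

theorem one_mem_grid : 1 ∈ P.grid n :=
  grid_mono (Nat.zero_le n) ⟨1, by simp [P.mesh_zero]⟩

theorem add_mesh_le_of_lt (hu : u ∈ P.grid n) (hv : v ∈ P.grid n) (h : u < v) :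
    u + P.mesh n ≤ v := by
  obtain ⟨m, rfl⟩ := hu
  obtain ⟨m', rfl⟩ := hv
  have hlt : (m : ℝ) < m' := lt_of_mul_lt_mul_right h (P.mesh_pos n).le
  have hle : (m : ℝ) + 1 ≤ m' := by exact_mod_cast hlt
  nlinarith [P.mesh_pos n]

theorem eq_of_mem_grid (hu : u ∈ P.grid n) (hv : v ∈ P.grid n) (h : |u - v| < P.mesh n) :
    u = v := by
  obtain ⟨h₁, h₂⟩ := abs_lt.1 h
  rcases lt_trichotomy u v with huv | huv | huv
  · linarith [add_mesh_le_of_lt hu hv huv]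
  · exact huv
  · linarith [add_mesh_le_of_lt hv hu huv]

theorem exists_grid_lt_one (hs : s ∈ unitInterval) :
    ∃ v ∈ P.grid n, v < 1 ∧ v ≤ s ∧ s ≤ v + P.mesh n := by
  have hpos := P.mesh_pos n
  rcases hs.2.eq_or_lt with rfl | hs1
  · obtain ⟨m, hm⟩ := one_mem_grid (P := P) (n := n)
    obtain ⟨k, rfl⟩ : ∃ k, m = k + 1 := Nat.exists_eq_succ_of_ne_zero (by rintro rfl; simp at hm)
    push_cast at hm
    exact ⟨k * P.mesh n, ⟨k, rfl⟩, by linarith, by linarith, by linarith⟩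
  · have hle : ⌊s / P.mesh n⌋₊ * P.mesh n ≤ s :=
      (le_div_iff₀ hpos).1 (Nat.floor_le (div_nonneg hs.1 hpos.le))
    have hlt := (div_lt_iff₀ hpos).1 (Nat.lt_floor_add_one (s / P.mesh n))
    exact ⟨_, ⟨_, rfl⟩, hle.trans_lt hs1, hle, by linarith⟩

theorem mul_mesh_lt {t : ℕ} (ht : t < P.N n) : t * P.mesh (n + 1) < P.mesh n := by
  rw [P.mesh_eq n]
  exact mul_lt_mul_of_pos_right (by exact_mod_cast ht) (P.mesh_pos (n + 1))

theorem add_mul_mesh_lt_one (hu : u ∈ P.grid n) (hu1 : u < 1) {t : ℕ} (ht : t < P.N n) :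
    u + t * P.mesh (n + 1) < 1 := by
  linarith [add_mesh_le_of_lt hu one_mem_grid hu1, mul_mesh_lt ht]

theorem add_mul_mesh_mem_grid_iff (hu : u ∈ P.grid n) {t : ℕ} (ht : t < P.N n) :
    u + t * P.mesh (n + 1) ∈ P.grid n ↔ t = 0 := by
  have hpos := P.mesh_pos (n + 1)
  refine ⟨fun h => ?_, by rintro rfl; simpa using hu⟩
  have habs : |u + t * P.mesh (n + 1) - u| < P.mesh n := by
    rw [add_sub_cancel_left, abs_of_nonneg (by positivity)]
    exact mul_mesh_lt ht
  have hzero : t * P.mesh (n + 1) = 0 := by linarith [eq_of_mem_grid h hu habs]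
  exact_mod_cast (mul_eq_zero.1 hzero).resolve_right hpos.ne'

theorem exists_add_mul_mesh_of_mem_grid_succ (hs : s ∈ P.grid (n + 1)) :
    ∃ u ∈ P.grid n, ∃ t < P.N n, s = u + t * P.mesh (n + 1) := by
  obtain ⟨m, rfl⟩ := hs
  refine ⟨_, ⟨m / P.N n, rfl⟩, m % P.N n, Nat.mod_lt _ (P.N_pos n), ?_⟩
  have hdiv : (m : ℝ) = P.N n * (m / P.N n : ℕ) + (m % P.N n : ℕ) := by
    exact_mod_cast (Nat.div_add_mod m (P.N n)).symm
  rw [P.mesh_eq n]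
  linear_combination P.mesh (n + 1) * hdiv

theorem sum_mul_scale_mem_grid {t : ℕ → ℕ} (ht : ∀ j < n, t j < P.N j) :
    ∑ j ∈ Finset.range n, t j * P.scale j ∈ P.grid n ∧
      ∑ j ∈ Finset.range n, t j * P.scale j < 1 := by
  induction n with
  | zero => simpa using zero_mem_grid
  | succ n ih =>
    obtain ⟨hmem, hlt⟩ := ih fun j hj => ht j (by omega)
    rw [Finset.sum_range_succ]
    exact ⟨add_mul_mesh_mem_grid hmem _, add_mul_mesh_lt_one hmem hlt (ht n n.lt_succ_self)⟩

theorem exists_sum_mul_scale_of_mem_grid (hs : s ∈ P.grid n) (hs1 : s < 1) :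
    ∃ t : ℕ → ℕ, (∀ j < n, t j < P.N j) ∧ s = ∑ j ∈ Finset.range n, t j * P.scale j := by
  induction n generalizing s with
  | zero =>
    obtain ⟨m, rfl⟩ := hs
    rw [P.mesh_zero, mul_one, Nat.cast_lt_one] at hs1
    exact ⟨0, by simp, by simp [hs1]⟩
  | succ n ih =>
    obtain ⟨u, hu, d, hd, rfl⟩ := exists_add_mul_mesh_of_mem_grid_succ hs
    have hpos := P.mesh_pos (n + 1)
    obtain ⟨t, ht, rfl⟩ := ih hu (lt_of_le_of_lt (le_add_of_nonneg_right (by positivity)) hs1)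
    refine ⟨Function.update t n d, fun j hj => ?_, ?_⟩
    · rcases Nat.lt_succ_iff_lt_or_eq.1 hj with h | rfl
      · simpa only [Function.update_of_ne h.ne] using ht j h
      · simpa only [Function.update_self] using hd
    · rw [Finset.sum_range_succ, Function.update_self, scale_eq_mesh]
      refine congrArg (· + _) (Finset.sum_congr rfl fun j hj => ?_)
      rw [Function.update_of_ne (Finset.mem_range.1 hj).ne]

end Grids

section Heights

variable {P} {n i j : ℕ} {s v : ℝ}

theorem mem_wormholeHeights_iff :
    s ∈ P.wormholeHeights i ↔ s ∈ P.grid (i + 1) ∧ s ∉ P.grid i ∧ s < 1 := by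
  have hnotMem {t : ℕ → ℕ} (ht : ∀ j < i + 1, t j < P.N j) :
      ∑ j ∈ Finset.range (i + 1), t j * P.scale j ∉ P.grid i ↔ 1 ≤ t i := by
    rw [Finset.sum_range_succ, scale_eq_mesh, add_mul_mesh_mem_grid_iff
      (sum_mul_scale_mem_grid fun j hj => ht j (by omega)).1 (ht i i.lt_succ_self),
      Nat.one_le_iff_ne_zero]
  constructor
  · rintro ⟨t, ht, hpos, hlt, rfl⟩
    have ht' : ∀ j < i + 1, t j < P.N j := fun j hj => by
      rcases Nat.lt_succ_iff_lt_or_eq.1 hj with h | rfl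
      exacts [ht j h, hlt]
    exact ⟨(sum_mul_scale_mem_grid ht').1, (hnotMem ht').2 hpos, (sum_mul_scale_mem_grid ht').2⟩
  · rintro ⟨hs, hsi, hs1⟩
    obtain ⟨t, ht, rfl⟩ := exists_sum_mul_scale_of_mem_grid hs hs1
    exact ⟨t, fun j hj => ht j (by omega), (hnotMem ht).1 hsi, ht i i.lt_succ_self, rfl⟩

theorem wormholeHeights_subset_grid (h : i < n) : P.wormholeHeights i ⊆ P.grid n :=
  fun _ hs => grid_mono h (mem_wormholeHeights_iff.1 hs).1

theorem eq_of_mem_wormholeHeights (hi : s ∈ P.wormholeHeights i) (hj : s ∈ P.wormholeHeights j) :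
    i = j := by
  by_contra hne
  wlog hij : i < j generalizing i j
  · exact this hj hi (Ne.symm hne) (by omega)
  exact (mem_wormholeHeights_iff.1 hj).2.1 (wormholeHeights_subset_grid hij hi)

theorem wormholeHeights_subset_unitInterval : P.wormholeHeights i ⊆ unitInterval := fun _ hs =>
  have hs := mem_wormholeHeights_iff.1 hs
  ⟨nonneg_of_mem_grid hs.1, hs.2.2.le⟩

theorem wormholeHeights_finite (i : ℕ) : (P.wormholeHeights i).Finite := by
  refine ((finite_Iic ⌊1 / P.mesh (i + 1)⌋₊).image fun m : ℕ => m * P.mesh (i + 1)).subset ?_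
  intro s hs
  obtain ⟨⟨m, rfl⟩, -, hs1⟩ := mem_wormholeHeights_iff.1 hs
  exact ⟨m, Nat.le_floor ((le_div_iff₀ (P.mesh_pos _)).2 hs1.le), rfl⟩

theorem add_mesh_mem_wormholeHeights (hv : v ∈ P.grid n) (hv1 : v < 1) (hi : n ≤ i) :
    v + P.mesh (i + 1) ∈ P.wormholeHeights i := by
  have hv := grid_mono hi hv
  have hone : 1 < P.N i := lt_of_lt_of_le (by norm_num) (P.four_le_N i)
  have hmem := add_mul_mesh_mem_grid hv 1
  have hnotMem := (add_mul_mesh_mem_grid_iff hv hone).not.2 one_ne_zero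
  have hlt := add_mul_mesh_lt_one hv hv1 hone
  rw [Nat.cast_one, one_mul] at hmem hnotMem hlt
  exact mem_wormholeHeights_iff.2 ⟨hmem, hnotMem, hlt⟩

theorem wormholeHeights_nonempty (i : ℕ) : (P.wormholeHeights i).Nonempty :=
  ⟨_, add_mesh_mem_wormholeHeights zero_mem_grid one_pos i.zero_le⟩

theorem exists_grid_of_mem_shortcutHeights (hs : s ∈ P.shortcutHeights i) :
    ∃ u ∈ P.grid (i + 1), u < 1 ∧ s = u + P.mesh (i + 1) / 2 := by
  obtain ⟨t, ht, -, hlt, rfl⟩ := hs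
  have ht' : ∀ j < i + 1, t j < P.N j := fun j hj => by
    rcases Nat.lt_succ_iff_lt_or_eq.1 hj with h | rfl
    exacts [ht j h, by omega]
  exact ⟨_, (sum_mul_scale_mem_grid ht').1, (sum_mul_scale_mem_grid ht').2, rfl⟩

theorem shortcutHeights_subset_wormholeHeights :
    P.shortcutHeights i ⊆ P.wormholeHeights (i + 1) := by
  intro s hs
  obtain ⟨u, hu, hu1, rfl⟩ := exists_grid_of_mem_shortcutHeights hs
  obtain ⟨k, hk⟩ := P.N_even (i + 1)
  have hkN : k < P.N (i + 1) := by have := P.four_le_N (i + 1); omega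
  have hhalf : P.mesh (i + 1) / 2 = k * P.mesh (i + 2) := by
    rw [P.mesh_eq (i + 1), hk]
    push_cast
    ring
  rw [hhalf]
  exact mem_wormholeHeights_iff.2 ⟨add_mul_mesh_mem_grid hu k,
    (add_mul_mesh_mem_grid_iff hu hkN).not.2 (by omega), add_mul_mesh_lt_one hu hu1 hkN⟩

theorem eq_of_mem_shortcutHeights (hi : s ∈ P.shortcutHeights i) (hj : s ∈ P.shortcutHeights j) :
    i = j :=
  Nat.succ_injective (eq_of_mem_wormholeHeights (shortcutHeights_subset_wormholeHeights hi)
    (shortcutHeights_subset_wormholeHeights hj))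

theorem half_mesh_le_infDist (hs : s ∈ P.shortcutHeights i) :
    P.mesh (i + 1) / 2 ≤ Metric.infDist s (P.wormholeHeights i) := by
  obtain ⟨u, hu, -, rfl⟩ := exists_grid_of_mem_shortcutHeights hs
  refine (Metric.le_infDist (wormholeHeights_nonempty i)).2 fun {w} hw => ?_
  have hw := wormholeHeights_subset_grid i.lt_succ_self hw
  rw [Real.dist_eq, le_abs]
  rcases le_or_gt w u with h | h
  · left
    linarith
  · right
    linarith [add_mesh_le_of_lt hu hw h]

end Heights

end LaaksoData

end

noncomputable section

open Set Filter Topology MeasureTheory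

section HausdorffMeasure

theorem hausdorffMeasure_image_iUnion_le {ι X Y : Type*} [Countable ι] [EMetricSpace X]
    [MeasurableSpace X] [BorelSpace X] [EMetricSpace Y] [MeasurableSpace Y] [BorelSpace Y]
    {f : X → Y} {s : ι → Set X} {K : NNReal} {d : ℝ} (hd : 0 ≤ d)
    (hs : ∀ i, MeasurableSet (s i)) (hdisj : Pairwise (Function.onFun Disjoint s))
    (hf : ∀ i, LipschitzOnWith K f (s i)) :
    μH[d] (f '' ⋃ i, s i) ≤ (K : ℝ≥0∞) ^ d * μH[d] (⋃ i, s i) := by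
  rw [image_iUnion, measure_iUnion hdisj hs, ← ENNReal.tsum_mul_left]
  exact (measure_iUnion_le _).trans
    (ENNReal.tsum_le_tsum fun i => (hf i).hausdorffMeasure_image_le hd)

end HausdorffMeasure

section Concatenation

theorem exists_lift_trans {E B : Type*} [TopologicalSpace B] {π : E → B} {x y z : B}
    {γ γ' : unitInterval → E} {p : Path x y} {p' : Path y z} (hγ : π ∘ γ = p)
    (hγ' : π ∘ γ' = p') :
    ∃ β : unitInterval → E, π ∘ β = p.trans p' ∧ range β ⊆ range γ ∪ range γ' := by
  refine ⟨fun t => if h : (t : ℝ) ≤ 1 / 2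
    then γ ⟨2 * t, (unitInterval.mul_pos_mem_iff zero_lt_two).2 ⟨t.2.1, h⟩⟩
    else γ' ⟨2 * t - 1, unitInterval.two_mul_sub_one_mem_iff.2 ⟨(not_le.1 h).le, t.2.2⟩⟩,
    funext fun t => ?_, ?_⟩
  · rw [Path.trans_apply, ← hγ, ← hγ']
    simp only [Function.comp_apply]
    split_ifs <;> rfl
  · rintro _ ⟨t, rfl⟩
    dsimp only
    split_ifs
    exacts [Or.inl (mem_range_self _), Or.inr (mem_range_self _)]

end Concatenation

namespace LaaksoData

variable {P : LaaksoData} {n : ℕ}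

section Digits

theorem dist_digits_of_ne {x y : P.Digits} (hxy : x ≠ y) :
    dist x y = P.θ ^ (PiNat.firstDiff (E := fun _ => Fin P.M) x y + 1) :=
  if_neg hxy

theorem dist_digits_lt_iff {x y : P.Digits} : dist x y < P.θ ^ n ↔ ∀ j < n, x j = y j := by
  have hθ : P.θ < 1 := P.θ_le.trans_lt (by norm_num)
  by_cases hxy : x = y
  · simp [hxy, pow_pos P.θ_pos]
  · rw [dist_digits_of_ne hxy, pow_lt_pow_iff_right_of_lt_one₀ P.θ_pos hθ, Nat.lt_succ_iff]
    exact (PiNat.mem_cylinder_iff_le_firstDiff hxy n).symm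

theorem tendsto_digits_iff {ι : Type*} {l : Filter ι} {f : ι → P.Digits} {a : P.Digits} :
    Tendsto f l (𝓝 a) ↔ ∀ j, ∀ᶠ u in l, f u j = a j := by
  rw [(Metric.nhds_basis_ball_pow P.θ_pos (P.θ_le.trans_lt (by norm_num))).tendsto_right_iff]
  simp only [Metric.mem_ball, dist_digits_lt_iff, true_imp_iff]
  refine ⟨fun h j => (h (j + 1)).mono fun u hu => hu j j.lt_succ_self, fun h n => ?_⟩
  simpa only [mem_Iio] using (eventually_all_finite (finite_Iio n)).2 fun j _ => h j

theorem eventually_digits_eq (a : P.Digits) (j : ℕ) : ∀ᶠ b in 𝓝 a, b j = a j :=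
  tendsto_digits_iff.1 tendsto_id j

instance : CompactSpace P.Digits := by
  have hcont : @Continuous (ℕ → Fin P.M) P.Digits _ _ id :=
    continuous_iff_continuousAt.2 fun x => tendsto_digits_iff.2 fun j =>
      have hj : ContinuousAt (fun y : ℕ → Fin P.M => y j) x := (continuous_apply j).continuousAt
      hj.eventually (IsOpen.mem_nhds (isOpen_discrete {x j}) rfl)
  exact Function.Surjective.compactSpace hcont Function.surjective_id

theorem continuous_proj : Continuous P.proj := continuous_quot_mk

theorem continuous_height : Continuous P.height :=
  continuous_quot_lift _ (continuous_subtype_val.comp continuous_fst)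

end Digits

section Curves

/-- The curves admitted in the definition of the Laakso distance from `x` to `y`: only the
projection of `γ` to `P.Space` is continuous. -/
def IsCurve (γ : unitInterval → P.Cover) (x y : P.Space) : Prop :=
  Continuous (P.proj ∘ γ) ∧ P.proj (γ 0) = x ∧ P.proj (γ 1) = y

/-- The Laakso distance before conversion to a real number. -/
def laaksoEDist (x y : P.Space) : ℝ≥0∞ :=
  ⨅ (γ : unitInterval → P.Cover) (_ : IsCurve γ x y), μH[1] (range γ)

theorem laaksoDist_eq_toReal (x y : P.Space) : P.laaksoDist x y = (laaksoEDist x y).toReal := rfl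

theorem laaksoEDist_le {x y : P.Space} {γ : unitInterval → P.Cover} (h : IsCurve γ x y) :
    laaksoEDist x y ≤ μH[1] (range γ) :=
  iInf₂_le γ h

theorem exists_isCurve_of_laaksoEDist_lt {x y : P.Space} {L : ℝ≥0∞} (h : laaksoEDist x y < L) :
    ∃ γ : unitInterval → P.Cover, IsCurve γ x y ∧ μH[1] (range γ) < L := by
  simpa only [laaksoEDist, iInf_lt_iff, exists_prop] using h

theorem IsCurve.exists_trans {x y z : P.Space} {γ γ' : unitInterval → P.Cover}
    (h : IsCurve γ x y) (h' : IsCurve γ' y z) :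
    ∃ β, IsCurve β x z ∧ range β ⊆ range γ ∪ range γ' := by
  let p : Path x y := ⟨⟨P.proj ∘ γ, h.1⟩, h.2.1, h.2.2⟩
  let p' : Path y z := ⟨⟨P.proj ∘ γ', h'.1⟩, h'.2.1, h'.2.2⟩
  obtain ⟨β, hβ, hrange⟩ := exists_lift_trans (π := P.proj) (γ := γ) (γ' := γ') (p := p)
    (p' := p') rfl rfl
  refine ⟨β, ⟨hβ ▸ (p.trans p').continuous, ?_, ?_⟩, hrange⟩
  · exact (congrFun hβ 0).trans (p.trans p').source
  · exact (congrFun hβ 1).trans (p.trans p').target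

theorem laaksoEDist_triangle (x y z : P.Space) :
    laaksoEDist x z ≤ laaksoEDist x y + laaksoEDist y z := by
  simp only [laaksoEDist, ENNReal.iInf_add, ENNReal.add_iInf]
  refine le_iInf₂ fun γ' hγ' => le_iInf₂ fun γ hγ => ?_
  obtain ⟨β, hβ, hrange⟩ := hγ.exists_trans hγ'
  exact (laaksoEDist_le hβ).trans ((measure_mono hrange).trans (measure_union_le _ _))

theorem laaksoEDist_le_of_continuous {c : ℝ → P.Cover} (hc : Continuous (P.proj ∘ c)) (s t : ℝ) :
    laaksoEDist (P.proj (c s)) (P.proj (c t)) ≤ μH[1] (c '' uIcc s t) := by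
  let line (u : unitInterval) : ℝ := AffineMap.lineMap s t (u : ℝ)
  have hline : Continuous line := AffineMap.lineMap_continuous.comp continuous_subtype_val
  have hcurve : IsCurve (c ∘ line) (P.proj (c s)) (P.proj (c t)) :=
    ⟨hc.comp hline, by simp [line], by simp [line]⟩
  refine (laaksoEDist_le hcurve).trans (measure_mono ?_)
  rintro _ ⟨u, rfl⟩
  refine ⟨line u, ?_, rfl⟩
  rw [← segment_eq_uIcc, segment_eq_image_lineMap]
  exact mem_image_of_mem _ u.2

/-- The vertical line with digits `a`, parametrised by height and constant outside `[0, 1]`. -/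
def vertical (a : P.Digits) (s : ℝ) : P.Cover := (projIcc 0 1 zero_le_one s, a)

theorem vertical_coe (a : P.Digits) (s : unitInterval) : vertical a s = (s, a) :=
  Prod.ext (projIcc_val zero_le_one s) rfl

theorem lipschitzWith_vertical (a : P.Digits) : LipschitzWith 1 (vertical a) :=
  ((LipschitzWith.projIcc zero_le_one).prodMk (LipschitzWith.const a)).weaken (by simp)

theorem laaksoEDist_vertical_le (a : P.Digits) (s t : unitInterval) :
    laaksoEDist (P.proj (s, a)) (P.proj (t, a)) ≤ ENNReal.ofReal |(s : ℝ) - t| := by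
  have h := laaksoEDist_le_of_continuous
    (continuous_proj.comp (lipschitzWith_vertical a).continuous) s t
  rw [vertical_coe, vertical_coe] at h
  refine (h.trans ((lipschitzWith_vertical a).lipschitzOnWith.hausdorffMeasure_image_le
    zero_le_one)).trans_eq ?_
  rw [hausdorffMeasure_real, uIcc, Real.volume_Icc, sup_sub_inf_eq_abs_sub, abs_sub_comm]
  simp

end Curves

section Climbing

/-- The digits reached from `a` after climbing by `h`, when the digit of index `j` is changed from
`a j` to `b j` at the wormhole passed after climbing by `mesh (j + 1)`. -/
def switch (a b : P.Digits) (h : ℝ) : P.Digits := fun j => if h < P.mesh (j + 1) then a j else b j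

/-- The left limit of `switch a b` at `h`. -/
def switchLeft (a b : P.Digits) (h : ℝ) : P.Digits :=
  fun j => if h ≤ P.mesh (j + 1) then a j else b j

/-- The curve that climbs from height `v` and changes the digits `a` to `b` on its way. -/
def climb (v : ℝ) (a b : P.Digits) (h : ℝ) : P.Cover := vertical (switch a b h) (v + h)

theorem tendsto_switch (a b : P.Digits) (h₀ : ℝ) :
    Tendsto (switch a b) (𝓝[≥] h₀) (𝓝 (switch a b h₀)) := by
  refine tendsto_digits_iff.2 fun j => ?_
  rcases lt_or_ge h₀ (P.mesh (j + 1)) with hj | hj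
  · filter_upwards [mem_nhdsWithin_of_mem_nhds (Iio_mem_nhds hj)] with h hh
    exact (if_pos hh).trans (if_pos hj).symm
  · filter_upwards [self_mem_nhdsWithin] with h hh
    exact (if_neg (hj.trans hh).not_gt).trans (if_neg hj.not_gt).symm

theorem tendsto_switchLeft (a b : P.Digits) (h₀ : ℝ) :
    Tendsto (switch a b) (𝓝[<] h₀) (𝓝 (switchLeft a b h₀)) := by
  refine tendsto_digits_iff.2 fun j => ?_
  rcases le_or_gt h₀ (P.mesh (j + 1)) with hj | hj
  · filter_upwards [self_mem_nhdsWithin] with h hh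
    exact (if_pos (hh.trans_le hj)).trans (if_pos hj).symm
  · filter_upwards [mem_nhdsWithin_of_mem_nhds (Ioi_mem_nhds hj)] with h hh
    exact (if_neg (not_lt_of_gt hh)).trans (if_neg hj.not_ge).symm

theorem switch_eq_of_mem_Ico {k : ℕ} {h : ℝ} (a b : P.Digits)
    (hh : h ∈ Ico (P.mesh (k + 1)) (P.mesh k)) : switch a b h = switch a b (P.mesh (k + 1)) := by
  funext j
  refine if_congr ?_ rfl rfl
  refine ⟨hh.1.trans_lt, fun hj => hh.2.trans_le (P.mesh_strictAnti.antitone ?_)⟩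
  have := P.mesh_strictAnti.lt_iff_gt.1 hj
  omega

variable {v : ℝ} {a b : P.Digits}

theorem proj_vertical_switchLeft (hv : v ∈ P.grid n) (hv1 : v < 1) (hab : ∀ j < n, a j = b j)
    (h : ℝ) :
    P.proj (vertical (switchLeft a b h) (v + h)) = P.proj (vertical (switch a b h) (v + h)) := by
  have heq : ∀ j, (n ≤ j → h ≠ P.mesh (j + 1)) → switchLeft a b h j = switch a b h j := by
    intro j hj
    rcases lt_or_ge j n with hjn | hjn
    · simp only [switchLeft, switch, hab j hjn, ite_self]
    · simp only [switchLeft, switch, (hj hjn).le_iff_lt]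
  by_cases hex : ∃ i, n ≤ i ∧ h = P.mesh (i + 1)
  · obtain ⟨i, hi, rfl⟩ := hex
    have hmem := add_mesh_mem_wormholeHeights hv hv1 hi
    refine Quot.sound (Or.inr ⟨i, rfl, ?_, fun j hj => heq j fun _ hji => hj ?_⟩)
    · rwa [vertical, projIcc_of_mem _ (wormholeHeights_subset_unitInterval hmem)]
    · exact (Nat.succ_injective (P.mesh_strictAnti.injective hji)).symm
  · rw [show switchLeft a b h = switch a b h from funext fun j =>
      heq j fun hj hh => hex ⟨j, hj, hh⟩]

theorem continuous_proj_climb (hv : v ∈ P.grid n) (hv1 : v < 1) (hab : ∀ j < n, a j = b j) :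
    Continuous (P.proj ∘ climb v a b) := by
  refine continuous_iff_continuousAt.2 fun h₀ => ?_
  have hheight : Tendsto (fun h => projIcc 0 1 zero_le_one (v + h)) (𝓝 h₀)
      (𝓝 (projIcc 0 1 zero_le_one (v + h₀))) :=
    (continuous_projIcc.comp (continuous_const.add continuous_id)).tendsto h₀
  rw [ContinuousAt, ← nhdsLT_sup_nhdsGE, tendsto_sup]
  constructor
  · rw [Function.comp_apply, climb, ← proj_vertical_switchLeft hv hv1 hab]
    exact (continuous_proj.tendsto _).comp
      ((hheight.mono_left inf_le_left).prodMk_nhds (tendsto_switchLeft a b h₀))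
  · exact (continuous_proj.tendsto _).comp
      ((hheight.mono_left inf_le_left).prodMk_nhds (tendsto_switch a b h₀))

theorem hausdorffMeasure_climb_le (v : ℝ) (a b : P.Digits) (n : ℕ) :
    μH[1] (climb v a b '' Ico 0 (P.mesh n)) ≤ ENNReal.ofReal (P.mesh n) := by
  let piece (k : ℕ) : Set ℝ := Ico (P.mesh (n + k + 1)) (P.mesh (n + k))
  have hcover : Ico 0 (P.mesh n) ⊆ {0} ∪ ⋃ k, piece k := by
    rintro h ⟨h0, hn⟩
    rcases h0.eq_or_lt with rfl | h0
    · exact Or.inl rfl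
    · obtain ⟨k, hk, hmem⟩ := P.exists_mem_Ico_mesh h0 hn
      obtain ⟨l, rfl⟩ := Nat.exists_eq_add_of_le hk
      exact Or.inr (mem_iUnion.2 ⟨l, hmem⟩)
  have hsub : ⋃ k, piece k ⊆ Ico 0 (P.mesh n) := iUnion_subset fun k h hh =>
    ⟨(P.mesh_pos _).le.trans hh.1, hh.2.trans_le (P.mesh_strictAnti.antitone (by omega))⟩
  have hdisj : Pairwise (Function.onFun Disjoint piece) :=
    Antitone.pairwise_disjoint_on_Ico_succ (f := fun k => P.mesh (n + k))
      fun _ _ hkl => P.mesh_strictAnti.antitone (by omega)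
  have hlip : ∀ k, LipschitzOnWith 1 (climb v a b) (piece k) := fun k x hx y hy => by
    rw [climb, climb, switch_eq_of_mem_Ico a b hx, switch_eq_of_mem_Ico a b hy]
    simpa using lipschitzWith_vertical (switch a b (P.mesh (n + k + 1))) (v + x) (v + y)
  have := Measure.nullSingletonClass_hausdorff P.Cover (zero_lt_one (α := ℝ))
  calc μH[1] (climb v a b '' Ico 0 (P.mesh n))
    _ ≤ μH[1] (climb v a b '' {0}) + μH[1] (climb v a b '' ⋃ k, piece k) := by
      refine (measure_mono (image_mono hcover)).trans ?_
      rw [image_union]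
      exact measure_union_le _ _
    _ ≤ μH[1] (⋃ k, piece k) := by
      rw [image_singleton, measure_singleton, zero_add]
      simpa using hausdorffMeasure_image_iUnion_le zero_le_one (fun k => measurableSet_Ico) hdisj
        hlip
    _ ≤ ENNReal.ofReal (P.mesh n) := by
      refine (measure_mono hsub).trans_eq ?_
      rw [hausdorffMeasure_real, Real.volume_Ico, sub_zero]

theorem laaksoEDist_climb_le (hv : v ∈ P.grid n) (hv1 : v < 1) (hab : ∀ j < n, a j = b j) :
    laaksoEDist (P.proj (vertical a v)) (P.proj (vertical b (v + P.mesh (n + 1)))) ≤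
      ENNReal.ofReal (P.mesh n) := by
  have hstart : climb v a b 0 = vertical a v := by
    have : switch a b 0 = a := funext fun j => if_pos (P.mesh_pos (j + 1))
    rw [climb, this, add_zero]
  have hend : climb v a b (P.mesh (n + 1)) = vertical b (v + P.mesh (n + 1)) := by
    have : switch a b (P.mesh (n + 1)) = b := funext fun j => by
      rcases lt_or_ge j n with hj | hj
      · rw [switch, hab j hj, ite_self]
      · exact if_neg (P.mesh_strictAnti.antitone (by omega)).not_gt
    rw [climb, this]
  rw [← hstart, ← hend]
  refine (laaksoEDist_le_of_continuous (continuous_proj_climb hv hv1 hab) _ _).trans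
    ((measure_mono (image_mono ?_)).trans (hausdorffMeasure_climb_le v a b n))
  rw [uIcc_of_le (P.mesh_pos _).le]
  exact Icc_subset_Ico_right (P.mesh_strictAnti n.lt_succ_self)

/-- Move to a grid height just below, change the digits by climbing, and move to the target. -/
theorem laaksoEDist_le_of_digits_eq (hab : ∀ j < n, a j = b j) (s t : unitInterval) :
    laaksoEDist (P.proj (s, a)) (P.proj (t, b)) ≤
      ENNReal.ofReal (|(s : ℝ) - t| + 3 * P.mesh n) := by
  have hpos := P.mesh_pos n
  have hsucc := P.mesh_succ_le n
  have hsucc_pos := P.mesh_pos (n + 1)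
  obtain ⟨v, hv, hv1, hvs, hsv⟩ : ∃ v ∈ P.grid n, v < 1 ∧ v ≤ s ∧ (s : ℝ) ≤ v + P.mesh n :=
    exists_grid_lt_one s.2
  have hw := wormholeHeights_subset_unitInterval (add_mesh_mem_wormholeHeights hv hv1 le_rfl)
  let p : unitInterval := ⟨v, nonneg_of_mem_grid hv, hv1.le⟩
  let q : unitInterval := ⟨v + P.mesh (n + 1), hw⟩
  have hclimb : laaksoEDist (P.proj (p, a)) (P.proj (q, b)) ≤ ENNReal.ofReal (P.mesh n) := by
    have h := laaksoEDist_climb_le hv hv1 hab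
    rwa [vertical_coe a p, vertical_coe b q] at h
  calc laaksoEDist (P.proj (s, a)) (P.proj (t, b))
    _ ≤ laaksoEDist (P.proj (s, a)) (P.proj (p, a)) +
        (laaksoEDist (P.proj (p, a)) (P.proj (q, b)) +
          laaksoEDist (P.proj (q, b)) (P.proj (t, b))) :=
      (laaksoEDist_triangle _ _ _).trans (add_le_add le_rfl (laaksoEDist_triangle _ _ _))
    _ ≤ ENNReal.ofReal |(s : ℝ) - v| +
        (ENNReal.ofReal (P.mesh n) + ENNReal.ofReal |v + P.mesh (n + 1) - t|) :=
      add_le_add (laaksoEDist_vertical_le a s p)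
        (add_le_add hclimb (laaksoEDist_vertical_le b q t))
    _ ≤ ENNReal.ofReal (|(s : ℝ) - t| + 3 * P.mesh n) := by
      rw [← ENNReal.ofReal_add hpos.le (abs_nonneg _),
        ← ENNReal.ofReal_add (abs_nonneg _) (by positivity)]
      refine ENNReal.ofReal_le_ofReal ?_
      have h₁ : |(s : ℝ) - v| ≤ P.mesh n := abs_le.2 ⟨by linarith, by linarith⟩
      have h₂ : |v + P.mesh (n + 1) - s| ≤ P.mesh n := abs_le.2 ⟨by linarith, by linarith⟩
      linarith [abs_sub_le (v + P.mesh (n + 1)) s t]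

theorem laaksoEDist_ne_top (x y : P.Space) : laaksoEDist x y ≠ ⊤ := by
  obtain ⟨⟨s, a⟩, rfl⟩ := Quot.exists_rep x
  obtain ⟨⟨t, b⟩, rfl⟩ := Quot.exists_rep y
  exact ne_top_of_le_ne_top ENNReal.ofReal_ne_top
    (laaksoEDist_le_of_digits_eq (n := 0) (by simp) s t)

theorem laaksoDist_le_of_digits_eq (hab : ∀ j < n, a j = b j) (s t : unitInterval) :
    P.laaksoDist (P.proj (s, a)) (P.proj (t, b)) ≤ |(s : ℝ) - t| + 3 * P.mesh n := by
  have := P.mesh_pos n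
  exact ENNReal.toReal_le_of_le_ofReal (by positivity) (laaksoEDist_le_of_digits_eq hab s t)

theorem laaksoDist_vertical_le (a : P.Digits) (s t : unitInterval) :
    P.laaksoDist (P.proj (s, a)) (P.proj (t, a)) ≤ |(s : ℝ) - t| :=
  ENNReal.toReal_le_of_le_ofReal (abs_nonneg _) (laaksoEDist_vertical_le a s t)

end Climbing

end LaaksoData

end

noncomputable section

open Set Filter Topology MeasureTheory

namespace LaaksoData

variable {P : LaaksoData} {i j : ℕ} {α β : Fin P.M} {x y : P.Space}

section DigitSets

variable (P) in
/-- The points whose height is not a wormhole height of index `i` and whose digit of index `i`,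
which is then well defined, is `α`. -/
def digitSet (i : ℕ) (α : Fin P.M) : Set P.Space :=
  {x | Quot.lift (fun z : P.Cover => (z.1 : ℝ) ∉ P.wormholeHeights i ∧ z.2 i = α) (by
    rintro x y (rfl | ⟨j, h1, h2, h3⟩)
    · rfl
    · refine propext ?_
      rw [← h1]
      refine and_congr_right fun hx => ?_
      rw [h3 i fun hij => hx (hij ▸ h2)]) x}

theorem digit_unique (hα : x ∈ P.digitSet i α) (hβ : x ∈ P.digitSet i β) : α = β := by
  obtain ⟨z, rfl⟩ := Quot.exists_rep x
  exact hα.2.symm.trans hβ.2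

theorem exists_mem_digitSet (hx : P.height x ∉ P.wormholeHeights i) : ∃ α, x ∈ P.digitSet i α := by
  obtain ⟨z, rfl⟩ := Quot.exists_rep x
  exact ⟨z.2 i, hx, rfl⟩

theorem height_notMem_of_mem_digitSet (hx : x ∈ P.digitSet i α) :
    P.height x ∉ P.wormholeHeights i := by
  obtain ⟨z, rfl⟩ := Quot.exists_rep x
  exact hx.1

theorem eq_of_height_eq_of_digitSet (hh : P.height x = P.height y)
    (hd : ∀ i α, x ∈ P.digitSet i α → y ∈ P.digitSet i α) : x = y := by
  obtain ⟨⟨s, a⟩, rfl⟩ := Quot.exists_rep x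
  obtain ⟨⟨t, b⟩, rfl⟩ := Quot.exists_rep y
  obtain rfl : s = t := Subtype.ext hh
  have hW : ∀ i, a i ≠ b i → (s : ℝ) ∈ P.wormholeHeights i := fun i hi => by
    by_contra hs
    exact hi (hd i (a i) ⟨hs, rfl⟩).2.symm
  by_cases hab : a = b
  · rw [hab]
  · obtain ⟨i, hi⟩ := Function.ne_iff.1 hab
    refine Quot.sound (Or.inr ⟨i, rfl, hW i hi, fun j hj => ?_⟩)
    by_contra hne
    exact hj (eq_of_mem_wormholeHeights (hW j hne) (hW i hi))

theorem isOpen_digitSet (i : ℕ) (α : Fin P.M) : IsOpen (P.digitSet i α) := by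
  have hheight : IsOpen {z : P.Cover | (z.1 : ℝ) ∉ P.wormholeHeights i} :=
    (wormholeHeights_finite i).isClosed.isOpen_compl.preimage
      (continuous_subtype_val.comp continuous_fst)
  have hdigit : IsOpen {a : P.Digits | a i = α} := isOpen_iff_mem_nhds.2 fun a ha =>
    (eventually_digits_eq a i).mono fun b hb => hb.trans ha
  exact isOpen_coinduced.2 (hheight.inter (hdigit.preimage continuous_snd))

end DigitSets

section LaaksoDist

theorem abs_height_sub_le_hausdorffMeasure {γ : unitInterval → P.Cover} (h : IsCurve γ x y)
    (u v : unitInterval) :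
    ENNReal.ofReal |((γ u).1 : ℝ) - (γ v).1| ≤ μH[1] (range γ) := by
  let ht : P.Cover → ℝ := fun z => z.1
  have hcont : Continuous (ht ∘ γ) := continuous_height.comp h.1
  have hlip : LipschitzWith 1 ht :=
    ((LipschitzWith.subtype_val _).comp LipschitzWith.prod_fst).weaken (by simp)
  calc ENNReal.ofReal |((γ u).1 : ℝ) - (γ v).1|
    _ = μH[1] (uIcc (ht (γ v)) (ht (γ u))) := by rw [hausdorffMeasure_real, Real.volume_interval]
    _ ≤ μH[1] (ht '' range γ) := by
      rw [← range_comp]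
      exact measure_mono ((isPreconnected_range hcont).ordConnected.uIcc_subset ⟨v, rfl⟩ ⟨u, rfl⟩)
    _ ≤ μH[1] (range γ) := by simpa using hlip.hausdorffMeasure_image_le zero_le_one (range γ)

theorem exists_isCurve_of_laaksoDist_lt {L : ℝ} (h : P.laaksoDist x y < L) :
    ∃ γ : unitInterval → P.Cover, IsCurve γ x y ∧
      ∀ u v, |((γ u).1 : ℝ) - (γ v).1| < L := by
  rw [laaksoDist_eq_toReal, ← ENNReal.lt_ofReal_iff_toReal_lt (laaksoEDist_ne_top x y)] at h
  obtain ⟨γ, hγ, hL⟩ := exists_isCurve_of_laaksoEDist_lt h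
  exact ⟨γ, hγ, fun u v => (ENNReal.ofReal_lt_ofReal_iff_of_nonneg (abs_nonneg _)).1
    ((abs_height_sub_le_hausdorffMeasure hγ u v).trans_lt hL)⟩

theorem abs_height_sub_le_laaksoDist (x y : P.Space) :
    |P.height x - P.height y| ≤ P.laaksoDist x y := by
  refine le_of_forall_gt_imp_ge_of_dense fun L hL => ?_
  obtain ⟨γ, ⟨-, rfl, rfl⟩, hγ⟩ := exists_isCurve_of_laaksoDist_lt hL
  exact (hγ 0 1).le

/-- A curve that is too short to reach a wormhole of index `i` stays in the union of the disjoint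
open sets `digitSet i β`, hence in one of them. -/
theorem mem_digitSet_of_laaksoDist_lt (hx : x ∈ P.digitSet i α)
    (h : P.laaksoDist x y < Metric.infDist (P.height x) (P.wormholeHeights i)) :
    y ∈ P.digitSet i α := by
  obtain ⟨γ, ⟨hγ, rfl, rfl⟩, hosc⟩ := exists_isCurve_of_laaksoDist_lt h
  have hW : ∀ u, ((γ u).1 : ℝ) ∉ P.wormholeHeights i := fun u hu =>
    (hosc 0 u).not_ge (Metric.infDist_le_dist_of_mem hu)
  have hconst : IsLocallyConstant fun u => (γ u).2 i :=
    (IsLocallyConstant.iff_exists_open _).2 fun u =>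
      ⟨(P.proj ∘ γ) ⁻¹' P.digitSet i ((γ u).2 i), (isOpen_digitSet i _).preimage hγ, ⟨hW u, rfl⟩,
        fun v hv => hv.2⟩
  exact ⟨hW 1, (hconst.apply_eq_of_preconnectedSpace 1 0).trans hx.2⟩

end LaaksoDist

section JumpCost

variable {η : ℕ → Ioc (0 : ℝ) 1} {S : Set P.Space}

theorem height_mem_of_mem_shortcuts (hS : S ∈ P.shortcuts i) (hx : x ∈ S) :
    P.height x ∈ P.shortcutHeights i := by
  obtain ⟨t, ht, a, rfl⟩ := hS
  obtain ⟨z, ⟨rfl, -⟩, rfl⟩ := hx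
  exact ht

theorem height_eq_of_mem_shortcuts (hS : S ∈ P.shortcuts i) (hx : x ∈ S) (hy : y ∈ S) :
    P.height x = P.height y := by
  obtain ⟨t, -, a, rfl⟩ := hS
  obtain ⟨z, ⟨rfl, -⟩, rfl⟩ := hx
  obtain ⟨w, ⟨hw, -⟩, rfl⟩ := hy
  exact hw.symm

theorem mem_digitSet_of_mem_shortcuts (hij : j ≠ i) (hS : S ∈ P.shortcuts i) (hxS : x ∈ S)
    (hyS : y ∈ S) (hx : x ∈ P.digitSet j α) : y ∈ P.digitSet j α := by
  have hheight := height_eq_of_mem_shortcuts hS hxS hyS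
  obtain ⟨t, -, a, rfl⟩ := hS
  obtain ⟨z, ⟨-, hlow, hhigh⟩, rfl⟩ := hxS
  obtain ⟨w, ⟨-, hlow', hhigh'⟩, rfl⟩ := hyS
  have hdigit : w.2 j = z.2 j := by
    rcases lt_or_gt_of_ne hij with h | h
    · rw [hlow j h, hlow' j h]
    · rw [hhigh j h, hhigh' j h]
  exact ⟨fun hw => hx.1 (show P.height (P.proj z) ∈ _ from hheight ▸ hw), hdigit.trans hx.2⟩

theorem jumpCost_of_mem_shortcuts (hS : S ∈ P.shortcuts i) (hx : x ∈ S) (hy : y ∈ S) :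
    P.jumpCost η x y = η i * P.laaksoDist x y := by
  classical
  have hex : ∃ i, ∃ S ∈ P.shortcuts i, x ∈ S ∧ y ∈ S := ⟨i, S, hS, hx, hy⟩
  rw [jumpCost, dif_pos hex]
  obtain ⟨T, hT, hxT, -⟩ := Nat.find_spec hex
  rw [eq_of_mem_shortcutHeights (height_mem_of_mem_shortcuts hT hxT)
    (height_mem_of_mem_shortcuts hS hx)]

variable (P) in
theorem jumpCost_eq_or (η : ℕ → Ioc (0 : ℝ) 1) (x y : P.Space) :
    P.jumpCost η x y = P.laaksoDist x y ∨
      ∃ i, ∃ S ∈ P.shortcuts i, x ∈ S ∧ y ∈ S ∧ P.jumpCost η x y = η i * P.laaksoDist x y := by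
  by_cases h : ∃ i, ∃ S ∈ P.shortcuts i, x ∈ S ∧ y ∈ S
  · obtain ⟨i, S, hS, hx, hy⟩ := h
    exact Or.inr ⟨i, S, hS, hx, hy, jumpCost_of_mem_shortcuts hS hx hy⟩
  · exact Or.inl (dif_neg h)

theorem jumpCost_le_laaksoDist (x y : P.Space) : P.jumpCost η x y ≤ P.laaksoDist x y := by
  rcases jumpCost_eq_or P η x y with h | ⟨i, -, -, -, -, h⟩
  · exact h.le
  · exact h ▸ mul_le_of_le_one_left ENNReal.toReal_nonneg (η i).2.2

theorem abs_height_sub_le_jumpCost (x y : P.Space) :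
    |P.height x - P.height y| ≤ P.jumpCost η x y := by
  rcases jumpCost_eq_or P η x y with h | ⟨i, S, hS, hx, hy, -⟩
  · exact h ▸ abs_height_sub_le_laaksoDist x y
  · rw [height_eq_of_mem_shortcuts hS hx hy, sub_self, abs_zero]
    exact P.jumpCost_nonneg η x y

theorem mem_digitSet_of_jumpCost_lt (hx : x ∈ P.digitSet i α)
    (hno : ∀ S ∈ P.shortcuts i, x ∈ S → y ∉ S)
    (h : P.jumpCost η x y < Metric.infDist (P.height x) (P.wormholeHeights i)) :
    y ∈ P.digitSet i α := by
  rcases jumpCost_eq_or P η x y with heq | ⟨j, S, hS, hxS, hyS, -⟩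
  · exact mem_digitSet_of_laaksoDist_lt hx (heq ▸ h)
  · refine mem_digitSet_of_mem_shortcuts ?_ hS hxS hyS hx
    rintro rfl
    exact hno S hS hxS hyS

theorem mem_digitSet_of_jumpCost_lt_mul (hx : x ∈ P.digitSet i α)
    (h : P.jumpCost η x y < η i * Metric.infDist (P.height x) (P.wormholeHeights i)) :
    y ∈ P.digitSet i α := by
  by_cases hex : ∃ S ∈ P.shortcuts i, x ∈ S ∧ y ∈ S
  · obtain ⟨S, hS, hxS, hyS⟩ := hex
    rw [jumpCost_of_mem_shortcuts hS hxS hyS] at h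
    exact mem_digitSet_of_laaksoDist_lt hx (lt_of_mul_lt_mul_left h (η i).2.1.le)
  · exact mem_digitSet_of_jumpCost_lt hx (fun S hS hxS hyS => hex ⟨S, hS, hxS, hyS⟩)
      (h.trans_le (mul_le_of_le_one_left Metric.infDist_nonneg (η i).2.2))

end JumpCost

section ShortcutDist

variable {η : ℕ → Ioc (0 : ℝ) 1}

theorem shortcutDist_le_jumpCost (x y : P.Space) : P.shortcutDist η x y ≤ P.jumpCost η x y :=
  csInf_le (P.shortcutDist_bddBelow η x y)
    ⟨1, fun i => if i = 0 then x else y, le_rfl, by simp, by simp, by simp⟩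

theorem shortcutDist_le_laaksoDist (x y : P.Space) : P.shortcutDist η x y ≤ P.laaksoDist x y :=
  (shortcutDist_le_jumpCost x y).trans (jumpCost_le_laaksoDist x y)

theorem abs_height_sub_le_sum_jumpCost (c : ℕ → P.Space) (n : ℕ) :
    |P.height (c 0) - P.height (c n)| ≤
      ∑ i ∈ Finset.range n, P.jumpCost η (c i) (c (i + 1)) :=
  (dist_le_range_sum_dist (fun i => P.height (c i)) n).trans
    (Finset.sum_le_sum fun _ _ => abs_height_sub_le_jumpCost _ _)

theorem abs_height_sub_le_shortcutDist (x y : P.Space) :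
    |P.height x - P.height y| ≤ P.shortcutDist η x y := by
  refine le_csInf (P.shortcutDist_nonempty η x y) ?_
  rintro _ ⟨n, c, -, rfl, rfl, rfl⟩
  exact abs_height_sub_le_sum_jumpCost c n

theorem shortcutDist_induction {p : P.Space → Prop} {ε : ℝ} (h : P.shortcutDist η x y < ε)
    (hx : p x)
    (hjump : ∀ u v, |P.height u - P.height x| < ε → p u → P.jumpCost η u v < ε → p v) : p y := by
  obtain ⟨_, ⟨n, c, -, rfl, rfl, rfl⟩, hs⟩ :=
    exists_lt_of_csInf_lt (P.shortcutDist_nonempty η x y) h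
  have hpartial : ∀ m ≤ n, ∑ i ∈ Finset.range m, P.jumpCost η (c i) (c (i + 1)) < ε := fun m hm =>
    (Finset.sum_le_sum_of_subset_of_nonneg (Finset.range_mono hm) fun _ _ _ =>
      P.jumpCost_nonneg η _ _).trans_lt hs
  suffices ∀ m ≤ n, p (c m) from this n le_rfl
  intro m hm
  induction m with
  | zero => exact hx
  | succ m ih =>
    refine hjump (c m) _ ?_ (ih (by omega)) ?_
    · rw [abs_sub_comm]
      exact (abs_height_sub_le_sum_jumpCost c m).trans_lt (hpartial m (by omega))
    · exact (Finset.single_le_sum (f := fun i => P.jumpCost η (c i) (c (i + 1)))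
        (fun _ _ => P.jumpCost_nonneg η _ _) (Finset.self_mem_range_succ m)).trans_lt
        (hpartial (m + 1) hm)

/-- Near a height at positive distance from the wormholes of index `i`, changing the digit of index
`i` costs an amount bounded below. -/
theorem eq_of_shortcutDist_eq_zero (h : P.shortcutDist η x y = 0) : x = y := by
  have hheight := abs_height_sub_le_shortcutDist (η := η) x y
  rw [h, abs_nonpos_iff, sub_eq_zero] at hheight
  refine eq_of_height_eq_of_digitSet hheight fun i α hx => ?_
  have hη := (η i).2.1
  let δ := Metric.infDist (P.height x) (P.wormholeHeights i)
  have hδ : 0 < δ := ((wormholeHeights_finite i).isClosed.notMem_iff_infDist_pos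
    (wormholeHeights_nonempty i)).1 (height_notMem_of_mem_digitSet hx)
  have hlt : P.shortcutDist η x y < η i * (δ / 2) := by
    rw [h]
    positivity
  refine shortcutDist_induction (p := (· ∈ P.digitSet i α)) hlt hx fun u v hu hmem hcost => ?_
  have hδu : δ ≤ Metric.infDist (P.height u) (P.wormholeHeights i) + |P.height u - P.height x| := by
    rw [abs_sub_comm, ← Real.dist_eq]
    exact Metric.infDist_le_infDist_add_dist
  have hle : (η i : ℝ) * (δ / 2) ≤ δ / 2 := mul_le_of_le_one_left (by positivity) (η i).2.2
  exact mem_digitSet_of_jumpCost_lt_mul hmem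
    (hcost.trans_le (mul_le_mul_of_nonneg_left (by linarith) hη.le))

end ShortcutDist

end LaaksoData

end

noncomputable section

open Set Filter Topology MeasureTheory

namespace LaaksoData

variable {P : LaaksoData} {K i j : ℕ} {I : Set ℝ} {x y z : P.Space}

section Cells

/-- The digits of index less than `K` of `x` and `y` agree, except possibly those that can be
changed at a wormhole with height in `I`. -/
def SameCell (K : ℕ) (I : Set ℝ) (x y : P.Space) : Prop :=
  ∀ i < K, Disjoint (P.wormholeHeights i) I → ∀ α, x ∈ P.digitSet i α ↔ y ∈ P.digitSet i α

theorem SameCell.refl (x : P.Space) : SameCell K I x x := fun _ _ _ _ => Iff.rfl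

theorem SameCell.trans (h : SameCell K I x y) (h' : SameCell K I y z) : SameCell K I x z :=
  fun i hi hd α => (h i hi hd α).trans (h' i hi hd α)

theorem sameCell_of_mem_digitSet_imp (hx : P.height x ∈ I)
    (h : ∀ i < K, Disjoint (P.wormholeHeights i) I → ∀ α,
      x ∈ P.digitSet i α → y ∈ P.digitSet i α) : SameCell K I x y := by
  refine fun i hi hd α => ⟨h i hi hd α, fun hy => ?_⟩
  obtain ⟨β, hβ⟩ := exists_mem_digitSet (hd.notMem_of_mem_right hx)
  rwa [digit_unique hy (h i hi hd β hβ)]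

theorem SameCell.digit_eq {s t : unitInterval} {a b : P.Digits}
    (h : SameCell K I (P.proj (s, a)) (P.proj (t, b))) (hs : (s : ℝ) ∈ I) (hi : i < K)
    (hd : Disjoint (P.wormholeHeights i) I) : a i = b i :=
  ((h i hi hd (a i)).1 ⟨hd.notMem_of_mem_right hs, rfl⟩).2.symm

theorem eq_of_mem_wormholeHeights_of_abs_sub_lt {u v : ℝ} (hi : i < K) (hj : j < K)
    (hu : u ∈ P.wormholeHeights i) (hv : v ∈ P.wormholeHeights j) (huv : |u - v| < P.mesh K) :
    i = j := by
  obtain rfl := eq_of_mem_grid (wormholeHeights_subset_grid hi hu)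
    (wormholeHeights_subset_grid hj hv) huv
  exact eq_of_mem_wormholeHeights hu hv

theorem disjoint_wormholeHeights_of_mem (hI : ∀ u ∈ I, ∀ v ∈ I, |u - v| < P.mesh K) (hi : i < K)
    (hj : j < K) (hij : i ≠ j) {w : ℝ} (hw : w ∈ P.wormholeHeights j) (hwI : w ∈ I) :
    Disjoint (P.wormholeHeights i) I :=
  disjoint_left.2 fun v hv hvI =>
    hij (eq_of_mem_wormholeHeights_of_abs_sub_lt hi hj hv hw (hI v hvI w hwI))

theorem shortcutDist_le_of_digits_eq_of_ne {η : ℕ → Ioc (0 : ℝ) 1} {w : ℝ}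
    (hw : w ∈ P.wormholeHeights i) {s t : unitInterval} {a b : P.Digits}
    (hab : ∀ j < K, j ≠ i → a j = b j) :
    P.shortcutDist η (P.proj (s, a)) (P.proj (t, b)) ≤ |s - w| + |w - t| + 3 * P.mesh K := by
  let w₀ : unitInterval := ⟨w, wormholeHeights_subset_unitInterval hw⟩
  let a' : P.Digits := fun j => if j = i then b j else a j
  have hswitch : P.proj (w₀, a) = P.proj (w₀, a') :=
    Quot.sound (Or.inr ⟨i, rfl, hw, fun j hj => (if_neg hj).symm⟩)
  have hab' : ∀ j < K, a' j = b j := fun j hj => by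
    by_cases hji : j = i
    · exact if_pos hji
    · exact (if_neg hji).trans (hab j hj hji)
  have htoHole := (shortcutDist_le_laaksoDist (η := η) _ _).trans (laaksoDist_vertical_le a s w₀)
  have hfromHole :=
    (shortcutDist_le_laaksoDist (η := η) _ _).trans (laaksoDist_le_of_digits_eq hab' w₀ t)
  rw [← hswitch] at hfromHole
  exact (P.shortcutDist_triangle η _ _ _).trans
    ((add_le_add htoHole hfromHole).trans_eq (add_assoc _ _ _).symm)

theorem SameCell.shortcutDist_le {η : ℕ → Ioc (0 : ℝ) 1}
    (hI : ∀ u ∈ I, ∀ v ∈ I, |u - v| < P.mesh K) (hx : P.height x ∈ I) (hy : P.height y ∈ I)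
    (h : SameCell K I x y) : P.shortcutDist η x y ≤ 5 * P.mesh K := by
  obtain ⟨⟨s, a⟩, rfl⟩ := Quot.exists_rep x
  obtain ⟨⟨t, b⟩, rfl⟩ := Quot.exists_rep y
  by_cases hW : ∃ i < K, ∃ w ∈ P.wormholeHeights i, w ∈ I
  · obtain ⟨i, hi, w, hw, hwI⟩ := hW
    have hab : ∀ j < K, j ≠ i → a j = b j := fun j hj hji =>
      h.digit_eq hx hj (disjoint_wormholeHeights_of_mem hI hj hi hji hw hwI)
    have hsw : |(s : ℝ) - w| < P.mesh K := hI _ hx w hwI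
    have hwt : |w - (t : ℝ)| < P.mesh K := hI w hwI _ hy
    exact (shortcutDist_le_of_digits_eq_of_ne hw hab).trans (by linarith)
  · have hab : ∀ j < K, a j = b j := fun j hj =>
      h.digit_eq hx hj (disjoint_left.2 fun w hw hwI => hW ⟨j, hj, w, hw, hwI⟩)
    have hst : |(s : ℝ) - t| < P.mesh K := hI _ hx _ hy
    refine (shortcutDist_le_laaksoDist _ _).trans
      ((laaksoDist_le_of_digits_eq hab s t).trans ?_)
    linarith [P.mesh_pos K]

theorem shortcuts_eq_of_sameCell (hI : ∀ u ∈ I, ∀ v ∈ I, |u - v| < P.mesh (K + 1)) (hi : i < K)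
    (hj : j < K) {S T : Set P.Space} (hS : S ∈ P.shortcuts i) (hT : T ∈ P.shortcuts j) (hx : x ∈ S)
    (hy : y ∈ T) (hxI : P.height x ∈ I) (hyI : P.height y ∈ I) (h : SameCell K I x y) : S = T := by
  have hxW := shortcutHeights_subset_wormholeHeights (height_mem_of_mem_shortcuts hS hx)
  have hyW := shortcutHeights_subset_wormholeHeights (height_mem_of_mem_shortcuts hT hy)
  obtain rfl : i = j := Nat.succ_injective (eq_of_mem_wormholeHeights_of_abs_sub_lt
    (by omega) (by omega) hxW hyW (hI _ hxI _ hyI))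
  have hheight : P.height x = P.height y :=
    eq_of_mem_grid (wormholeHeights_subset_grid (by omega) hxW)
      (wormholeHeights_subset_grid (by omega) hyW) (hI _ hxI _ hyI)
  obtain ⟨t, -, a, rfl⟩ := hS
  obtain ⟨t', -, b, rfl⟩ := hT
  obtain ⟨⟨s, c⟩, hc, rfl⟩ := hx
  obtain ⟨⟨s', d⟩, hd, rfl⟩ := hy
  obtain rfl : t = t' := hc.1.symm.trans (hheight.trans hd.1)
  have hab : ∀ k < i, a k = b k := fun k hk =>
    calc a k
      _ = c k := (hc.2.1 k hk).symm
      _ = d k := h.digit_eq hxI (hk.trans hi) (disjoint_wormholeHeights_of_mem hI (by omega)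
        (by omega) (by omega : k ≠ i + 1) hxW hxI)
      _ = b k := hd.2.1 k hk
  congr 1
  ext z
  refine and_congr_right fun _ => and_congr_left fun _ => forall₂_congr fun k hk => ?_
  rw [hab k hk]

end Cells

section Links

variable {η : ℕ → Ioc (0 : ℝ) 1} {ρ C : ℝ}

theorem jumpCost_le_of_mem_shortcuts (hC : ∀ n, P.mesh n ≤ C * P.mesh (n + 1)) {S : Set P.Space}
    (hS : S ∈ P.shortcuts i) (hx : x ∈ S) (hy : y ∈ S) :
    P.jumpCost η x y ≤ 3 * C * (η i * P.mesh (i + 1)) := by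
  have hdist : P.laaksoDist x y ≤ 3 * (C * P.mesh (i + 1)) := by
    have hheight := height_eq_of_mem_shortcuts hS hx hy
    obtain ⟨t, -, e, rfl⟩ := hS
    obtain ⟨⟨s, a⟩, ha, rfl⟩ := hx
    obtain ⟨⟨s', b⟩, hb, rfl⟩ := hy
    have h := laaksoDist_le_of_digits_eq (fun k hk => (ha.2.1 k hk).trans (hb.2.1 k hk).symm) s s'
    have hss : (s : ℝ) = s' := hheight
    rw [hss, sub_self, abs_zero, zero_add] at h
    exact h.trans (mul_le_mul_of_nonneg_left (hC i) (by norm_num))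
  rw [jumpCost_of_mem_shortcuts hS hx hy]
  exact (mul_le_mul_of_nonneg_left hdist (η i).2.1.le).trans_eq (by ring)

theorem sameCell_or_exists_shortcut (hball : Metric.ball (P.height x) ρ ⊆ I)
    (h : P.jumpCost η x y < ρ) :
    SameCell K I x y ∨
      ∃ i < K, ∃ S ∈ P.shortcuts i, x ∈ S ∧ y ∈ S ∧ η i * P.mesh (i + 1) ≤ 2 * ρ := by
  refine or_iff_not_imp_right.2 fun hno => ?_
  have hxI := hball (Metric.mem_ball_self ((P.jumpCost_nonneg η x y).trans_lt h))
  refine sameCell_of_mem_digitSet_imp hxI fun i hi hd α hα => ?_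
  by_cases hex : ∃ S ∈ P.shortcuts i, x ∈ S ∧ y ∈ S
  · obtain ⟨S, hS, hxS, hyS⟩ := hex
    have hcost : 2 * ρ < η i * P.mesh (i + 1) := not_le.1 fun hcost =>
      hno ⟨i, hi, S, hS, hxS, hyS, hcost⟩
    have hgap := mul_le_mul_of_nonneg_left
      (half_mesh_le_infDist (height_mem_of_mem_shortcuts hS hxS)) (η i).2.1.le
    exact mem_digitSet_of_jumpCost_lt_mul hα (by linarith)
  · have hgap : ρ ≤ Metric.infDist (P.height x) (P.wormholeHeights i) :=
      (Metric.le_infDist (wormholeHeights_nonempty i)).2 fun {w} hw => by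
        rw [dist_comm]
        exact not_lt.1 fun hlt => disjoint_left.1 hd hw (hball hlt)
    exact mem_digitSet_of_jumpCost_lt hα (fun S hS hxS hyS => hex ⟨S, hS, hxS, hyS⟩)
      (h.trans_le hgap)

/-- `y` lies in the cell of `x`, or can be reached from it by a single shortcut whose cost is
comparable to at most `ρ`. Chains of jumps of cost less than `ρ` that stay above `I` remain in this
relation to their starting point. -/
def Linked (η : ℕ → Ioc (0 : ℝ) 1) (K : ℕ) (I : Set ℝ) (ρ : ℝ) (x y : P.Space) : Prop :=
  SameCell K I x y ∨ ∃ i < K, ∃ S ∈ P.shortcuts i, η i * P.mesh (i + 1) ≤ 2 * ρ ∧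
    ∃ p ∈ S, ∃ q ∈ S, P.height p ∈ I ∧ SameCell K I x p ∧ SameCell K I q y

theorem Linked.shortcutDist_le (hC0 : 0 < C) (hC : ∀ n, P.mesh n ≤ C * P.mesh (n + 1))
    (hI : ∀ u ∈ I, ∀ v ∈ I, |u - v| < P.mesh K) (hx : P.height x ∈ I) (hy : P.height y ∈ I)
    (hρ : 0 < ρ) (h : Linked η K I ρ x y) :
    P.shortcutDist η x y ≤ 10 * P.mesh K + 6 * C * ρ := by
  rcases h with h | ⟨i, -, S, hS, hcost, p, hp, q, hq, hpI, hxp, hqy⟩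
  · have hCρ : 0 < C * ρ := mul_pos hC0 hρ
    linarith [h.shortcutDist_le (η := η) hI hx hy, P.mesh_pos K]
  · have hqI : P.height q ∈ I := height_eq_of_mem_shortcuts hS hp hq ▸ hpI
    have hpq : P.shortcutDist η p q ≤ 3 * C * (2 * ρ) :=
      (shortcutDist_le_jumpCost p q).trans ((jumpCost_le_of_mem_shortcuts hC hS hp hq).trans
        (mul_le_mul_of_nonneg_left hcost (by positivity)))
    linarith [P.shortcutDist_triangle η x p y, P.shortcutDist_triangle η p q y,
      hxp.shortcutDist_le (η := η) hI hx hpI, hqy.shortcutDist_le (η := η) hI hqI hy]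

/-- A second shortcut taken within the cell reached by a first one is the same shortcut. -/
theorem Linked.jump (hI : ∀ u ∈ I, ∀ v ∈ I, |u - v| < P.mesh (K + 1))
    (hball : Metric.ball (P.height y) ρ ⊆ I) (h : Linked η K I ρ x y)
    (hyz : P.jumpCost η y z < ρ) : Linked η K I ρ x z := by
  have hy := hball (Metric.mem_ball_self ((P.jumpCost_nonneg η y z).trans_lt hyz))
  rcases sameCell_or_exists_shortcut (K := K) hball hyz with hs | ⟨j, hj, T, hT, hyT, hzT, hcost⟩
  · exact h.imp (fun h => h.trans hs)
      fun ⟨i, hi, S, hS, hc, p, hp, q, hq, hpI, hxp, hqy⟩ =>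
        ⟨i, hi, S, hS, hc, p, hp, q, hq, hpI, hxp, hqy.trans hs⟩
  · rcases h with h | ⟨i, hi, S, hS, hc, p, hp, q, hq, hpI, hxp, hqy⟩
    · exact Or.inr ⟨j, hj, T, hT, hcost, y, hyT, z, hzT, hy, h, SameCell.refl z⟩
    · have hqI : P.height q ∈ I := height_eq_of_mem_shortcuts hS hp hq ▸ hpI
      obtain rfl := shortcuts_eq_of_sameCell hI hi hj hS hT hq hyT hqI hy hqy
      exact Or.inr ⟨i, hi, S, hS, hc, p, hp, z, hzT, hpI, hxp, SameCell.refl z⟩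

theorem Linked.of_shortcutDist_lt (hI : ∀ u ∈ I, ∀ v ∈ I, |u - v| < P.mesh (K + 1))
    (hball : Metric.ball (P.height y) (2 * ρ) ⊆ I) (h : Linked η K I ρ x y)
    (hyz : P.shortcutDist η y z < ρ) : Linked η K I ρ x z :=
  shortcutDist_induction hyz h fun u v hu hxu huv =>
    hxu.jump hI ((Metric.ball_subset_ball' (by rw [Real.dist_eq]; linarith)).trans hball) huv

end Links

section Light

variable {η : ℕ → Ioc (0 : ℝ) 1} {E : Set ℝ} {r C : ℝ}

theorem linked_of_mem_rComponent {x y : P.ShortcutSpace η} (hr : 0 < r)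
    (hE : Metric.ediam E ≤ ENNReal.ofReal r) (hK : 10 * r < P.mesh (K + 1))
    (hx : x ∈ P.shortcutHeight η ⁻¹' E) (hy : y ∈ rComponent (P.shortcutHeight η ⁻¹' E) r x) :
    Linked η K (Metric.ball (P.height x) (5 * r)) (2 * r) x y := by
  have hI : ∀ u ∈ Metric.ball (P.height x) (5 * r), ∀ v ∈ Metric.ball (P.height x) (5 * r),
      |u - v| < P.mesh (K + 1) := fun u hu v hv => by
    rw [← Real.dist_eq]
    linarith [dist_triangle_right u v (P.height x), Metric.mem_ball.1 hu, Metric.mem_ball.1 hv]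
  have hheight : ∀ p ∈ P.shortcutHeight η ⁻¹' E, dist (P.height p) (P.height x) ≤ r :=
    fun p hp => dist_le_of_ediam_le hr.le hE hp hx
  obtain ⟨-, hchain⟩ := mem_rComponent_iff.1 hy
  clear hy
  induction hchain with
  | refl => exact Or.inl (SameCell.refl x)
  | tail _ hpq hlinked =>
    obtain ⟨hp, -, hdist⟩ := hpq
    refine hlinked.of_shortcutDist_lt hI
      (Metric.ball_subset_ball' (by linarith [hheight _ hp])) (lt_of_le_of_lt hdist (by linarith))

theorem shortcutDist_le_four (x y : P.Space) : P.shortcutDist η x y ≤ 4 := by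
  obtain ⟨⟨s, a⟩, rfl⟩ := Quot.exists_rep x
  obtain ⟨⟨t, b⟩, rfl⟩ := Quot.exists_rep y
  have h := (shortcutDist_le_laaksoDist (η := η) _ _).trans
    (laaksoDist_le_of_digits_eq (n := 0) (a := a) (b := b) (by simp) s t)
  rw [P.mesh_zero] at h
  have hst : |(s : ℝ) - t| ≤ 1 := Real.dist_le_of_mem_Icc_01 s.2 t.2
  exact h.trans (by linarith)

theorem dist_le_of_mem_rComponent {x y : P.ShortcutSpace η} (hC0 : 0 < C)
    (hC : ∀ n, P.mesh n ≤ C * P.mesh (n + 1)) (hr : 0 < r)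
    (hE : Metric.ediam E ≤ ENNReal.ofReal r) (hx : x ∈ P.shortcutHeight η ⁻¹' E)
    (hy : y ∈ rComponent (P.shortcutHeight η ⁻¹' E) r x) :
    dist x y ≤ (100 * C ^ 2 + 40 * C) * r := by
  rcases le_or_gt (P.mesh 1) (10 * r) with hlarge | hsmall
  · have hone : 1 ≤ C * (10 * r) :=
      P.mesh_zero ▸ (hC 0).trans (mul_le_mul_of_nonneg_left hlarge hC0.le)
    have hpos : 0 < C ^ 2 * r := by positivity
    exact (shortcutDist_le_four x y).trans (by linarith)
  · obtain ⟨k, hk, hk1, hk0⟩ := P.exists_mem_Ico_mesh (by positivity : 0 < 10 * r) hsmall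
    obtain ⟨K, rfl⟩ := Nat.exists_eq_add_of_le' hk
    have hball : ∀ z ∈ P.shortcutHeight η ⁻¹' E, P.height z ∈ Metric.ball (P.height x) (5 * r) :=
      fun z hz => lt_of_le_of_lt (dist_le_of_ediam_le hr.le hE hz hx) (by linarith)
    have hI : ∀ u ∈ Metric.ball (P.height x) (5 * r), ∀ v ∈ Metric.ball (P.height x) (5 * r),
        |u - v| < P.mesh K := fun u hu v hv => by
      rw [← Real.dist_eq]
      linarith [dist_triangle_right u v (P.height x), Metric.mem_ball.1 hu, Metric.mem_ball.1 hv,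
        P.mesh_strictAnti K.lt_succ_self]
    have hdist := (linked_of_mem_rComponent hr hE hk0 hx hy).shortcutDist_le hC0 hC hI (hball x hx)
      (hball y (rComponent_subset hy)) (by positivity)
    have hmesh : P.mesh K ≤ C * (C * (10 * r)) :=
      (hC K).trans (mul_le_mul_of_nonneg_left
        ((hC (K + 1)).trans (mul_le_mul_of_nonneg_left hk1 hC0.le)) hC0.le)
    have hpos : 0 < C * r := by positivity
    exact hdist.trans (by linarith)

theorem isLipschitzLight_shortcutHeight (P : LaaksoData) (η : ℕ → Ioc (0 : ℝ) 1) :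
    IsLipschitzLight (P.shortcutHeight η) := by
  obtain ⟨C, hC0, hC⟩ := P.exists_mesh_le
  have hC1 : 1 ≤ C := (le_mul_iff_one_le_left (P.mesh_pos 1)).1
    ((P.mesh_strictAnti zero_lt_one).le.trans (hC 0))
  refine isLipschitzLight_of_dist_le (C := 100 * C ^ 2 + 40 * C) (by positivity)
    (fun x y => ?_) fun E r hr hE x hx y hy => dist_le_of_mem_rComponent hC0 hC hr hE hx hy
  have hheight : dist (P.shortcutHeight η x) (P.shortcutHeight η y) ≤ dist x y :=
    abs_height_sub_le_shortcutDist x y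
  exact hheight.trans (le_mul_of_one_le_left dist_nonneg (by nlinarith))

end Light

end LaaksoData

end

noncomputable section

open Set Filter Topology

namespace LaaksoData

variable (P : LaaksoData) (η : ℕ → Ioc (0 : ℝ) 1)

/-- The identity from the Laakso space with the quotient topology to the shortcut space with the
topology of the shortcut distance. -/
def toShortcutSpace : P.Space → P.ShortcutSpace η := id

theorem continuous_toShortcutSpace : Continuous (P.toShortcutSpace η) := by
  refine continuous_coinduced_dom.2 (continuous_iff_continuousAt.2 ?_)
  rintro ⟨s, a⟩
  refine Metric.tendsto_nhds.2 fun ε hε => ?_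
  obtain ⟨n, hn⟩ := (P.mesh_tendsto.eventually (gt_mem_nhds (by positivity : 0 < ε / 6))).exists
  have hdigits : ∀ᶠ z : P.Cover in 𝓝 (s, a), ∀ j ∈ Iio n, z.2 j = a j :=
    (eventually_all_finite (finite_Iio n)).2 fun j _ =>
      (continuous_snd.tendsto (s, a)).eventually (eventually_digits_eq a j)
  have hheight : ∀ᶠ z : P.Cover in 𝓝 (s, a), |(z.1 : ℝ) - s| < ε / 2 :=
    (continuous_fst.tendsto (s, a)).eventually (Metric.ball_mem_nhds s (half_pos hε))
  filter_upwards [hdigits, hheight] with z hz hzs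
  calc P.shortcutDist η (P.proj z) (P.proj (s, a))
    _ ≤ |(z.1 : ℝ) - s| + 3 * P.mesh n :=
      (shortcutDist_le_laaksoDist _ _).trans (laaksoDist_le_of_digits_eq hz z.1 s)
    _ < ε := by linarith

instance : MetricSpace (P.ShortcutSpace η) where
  eq_of_dist_eq_zero := eq_of_shortcutDist_eq_zero

instance : CompactSpace (P.ShortcutSpace η) :=
  Function.Surjective.compactSpace ((P.continuous_toShortcutSpace η).comp continuous_proj)
    Quot.exists_rep

instance : PreconnectedSpace (P.ShortcutSpace η) := by
  refine ⟨isPreconnected_of_forall_pair fun x _ y _ => ?_⟩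
  obtain ⟨γ, ⟨hγ, h0, h1⟩, -⟩ := exists_isCurve_of_laaksoEDist_lt (laaksoEDist_ne_top x y).lt_top
  exact ⟨range (P.toShortcutSpace η ∘ P.proj ∘ γ), subset_univ _, ⟨0, h0⟩, ⟨1, h1⟩,
    isPreconnected_range ((P.continuous_toShortcutSpace η).comp hγ)⟩

instance : Nontrivial (P.ShortcutSpace η) := by
  let a : P.Digits := fun _ => P.letterOne
  refine ⟨P.proj (0, a), P.proj (1, a), fun h => zero_ne_one (α := ℝ) ?_⟩
  exact congrArg (P.shortcutHeight η) h

end LaaksoData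

end

theorem mainTheorem10 (P : LaaksoData) (η : ℕ → Set.Ioc (0 : ℝ) 1) :
    (∀ x y : P.ShortcutSpace η, dist x y = 0 → x = y) ∧
    topologicalDim (P.ShortcutSpace η) = 1 ∧
    nagataDim (P.ShortcutSpace η) = 1 ∧
    lipschitzDim (P.ShortcutSpace η) = 1 ∧
    IsLipschitzLight (P.shortcutHeight η) := by
  have hlight := LaaksoData.isLipschitzLight_shortcutHeight P η
  obtain ⟨htopological, hnagata, hlipschitz⟩ := hlight.dims_eq_one
  exact ⟨fun _ _ => LaaksoData.eq_of_shortcutDist_eq_zero, htopological, hnagata, hlipschitz,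
    hlight⟩
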